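/- Let $m=(m_0,m_1,\dots)$ be a bounded sequence of integers $m_n\ge 2$, let $G_m=\prod_n \mathbb Z/m_n\mathbb Z$ with Haar probability measure $\mu$, and put $M_0=1$, $M_{n+1}=m_nM_n$. For $n=\sum_k n_kM_k$ with $0\le n_k<m_k$ let $\psi_n(x)=\prod_k \exp(2\pi i x_k/m_k)^{n_k}$ be the Vilenkin system. Let $\mathcal F_n$ be the $\sigma$-algebra generated by the sets $I_n(x)=\{y: y_k=x_k \text{ for } k<n\}$. For $0<p<\infty$ the Hardy space $H_p$ consists of the (complex-valued) martingales $f=(f^{(n)})_{n\ge0}$ with respect to $(\mathcal F_n)$ such that $\|f\|_{H_p}:=\|\sup_n|f^{(n)}|\|_{L_p}<\infty$; an integrable function $g$ is identified with the martingale $(E[g\mid\mathcal F_n])_n$. For a martingale $f$ let $\widehat f(i)=\lim_{k\to\infty}\int f^{(k)}\overline{\psi_i}\,d\mu$, $S_nf=\sum_{k=0}^{n-1}\widehat f(k)\psi_k$ and $\sigma_nf=\frac1n\sum_{k=1}^{n}S_kf$. Put $\|g\|_{L_{p,\infty}}=\left(\sup_{\lambda>0}\lambda^p\mu(|g|>\lambda)\right)^{1/p}$.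 Let $0<p<1/2$. a) There is a constant $c_p$, depending only on $p$ (and on the fixed sequence $m$), such that for all $f\in H_p$ and all $n\in\mathbb N=\{0,1,2,\dots\}$ $$\|\sigma_{M_n+1}f\|_{H_p}\le c_p\,M_n^{1/p-2}\,\|f\|_{H_p}.$$ b) If $\Phi:\mathbb N\to\mathbb R$ is any nondecreasing function with $$\limsup_{k\to\infty}\frac{M_k^{1/p-2}}{\Phi(k)}=\infty$$ (terms with $\Phi(k)=0$, of which only finitely many can then occur, being read as $0$ here and below), then there is a martingale $f\in H_p$ with $$\sup_{k\in\mathbb N}\left\|\frac{\sigma_{M_k+1}f}{\Phi(k)}\right\|_{L_{p,\infty}}=\infty.$$ c) In particular, the operators $\sigma_{M_n+1}$, $n\in\mathbb N$, are not uniformly bounded from $H_p$ to $H_p$: there is no constant $C$ with $\|\sigma_{M_n+1}f\|_{H_p}\le C\|f\|_{H_p}$ for all $f\in H_p$ and all $n$. -/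

import Mathlib

open MeasureTheory Filter
open scoped ENNReal NNReal

namespace Vilenkin

/-- The complete direct product of the cyclic groups of integers modulo `m n`. -/
abbrev G (m : ℕ → ℕ) : Type := ∀ n, ZMod (m n)

/-- The Haar probability measure on `G m`: the product of the measures giving mass `1 / m n` to
every point of the `n`-th factor. -/
noncomputable def haar (m : ℕ → ℕ) : Measure (G m) :=
  Measure.infinitePi fun n => ((m n : ℝ≥0∞)⁻¹ • Measure.count : Measure (ZMod (m n)))

/-- The interval of all `y` whose first `n` coordinates agree with those of `x`. -/
def interval (m : ℕ → ℕ) (n : ℕ) (x : G m) : Set (G m) := {y | ∀ k < n, y k = x k}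

/-- The generalized number system: `M 0 = 1` and `M (n + 1) = m n * M n`. -/
def M (m : ℕ → ℕ) : ℕ → ℕ
  | 0 => 1
  | n + 1 => m n * M m n

/-- The `k`-th digit of `n` in the expansion `n = ∑ n_k M_k`, `0 ≤ n_k < m_k`. -/
def digit (m : ℕ → ℕ) (n k : ℕ) : ℕ := n / M m k % m k

/-- The generalized Rademacher function `r_k x = exp (2 π i x_k / m_k)`. -/
noncomputable def rademacher (m : ℕ → ℕ) (k : ℕ) (x : G m) : ℂ :=
  Complex.exp (2 * Real.pi * Complex.I * ((x k).val : ℂ) / (m k : ℂ))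

/-- The Vilenkin system `ψ_n = ∏ r_k ^ n_k` (only finitely many digits are nonzero). -/
noncomputable def psi (m : ℕ → ℕ) (n : ℕ) (x : G m) : ℂ :=
  ∏ᶠ k : ℕ, rademacher m k x ^ digit m n k

theorem measurableSet_interval (m : ℕ → ℕ) (n : ℕ) (x : G m) :
    MeasurableSet (interval m n x) := by
  have h : interval m n x = ⋂ k, ⋂ (_ : k < n), (fun y : G m => y k) ⁻¹' {x k} := by
    ext y
    simp [interval]
  rw [h]
  exact MeasurableSet.iInter fun k => MeasurableSet.iInter fun _ =>
    measurable_pi_apply k (MeasurableSpace.measurableSet_top)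

theorem interval_eq_iUnion (m : ℕ → ℕ) (n : ℕ) (x : G m) :
    interval m n x = ⋃ a : ZMod (m n), interval m (n + 1) (Function.update x n a) := by
  ext y
  simp only [interval, Set.mem_ofPred_eq, Set.mem_iUnion]
  constructor
  · intro h
    refine ⟨y n, fun k hk => ?_⟩
    rcases Nat.lt_succ_iff_lt_or_eq.mp hk with hk | rfl
    · rw [Function.update_of_ne hk.ne, h k hk]
    · rw [Function.update_self]
  · rintro ⟨a, h⟩ k hk
    rw [h k (by omega), Function.update_of_ne hk.ne]

theorem countable_zmod (n : ℕ) : Countable (ZMod n) := by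
  cases n with
  | zero => exact inferInstanceAs (Countable ℤ)
  | succ n => exact inferInstanceAs (Countable (Fin (n + 1)))

/-- The filtration whose `n`-th σ-algebra is generated by the intervals `interval m n x`. -/
def filtration (m : ℕ → ℕ) : Filtration ℕ (MeasurableSpace.pi : MeasurableSpace (G m)) where
  seq n := MeasurableSpace.generateFrom (Set.range (interval m n))
  mono' := by
    refine monotone_nat_of_le_succ fun n => MeasurableSpace.generateFrom_le ?_
    rintro _ ⟨x, rfl⟩
    have := countable_zmod (m n)
    rw [interval_eq_iUnion]
    exact MeasurableSet.iUnion fun a => MeasurableSpace.measurableSet_generateFrom ⟨_, rfl⟩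
  le' := by
    intro n
    refine MeasurableSpace.generateFrom_le ?_
    rintro _ ⟨x, rfl⟩
    exact measurableSet_interval m n x

/-- The Hardy quasi-norm `‖sup_n |f n|‖_p` of a sequence of functions. -/
noncomputable def hardyNorm (m : ℕ → ℕ) (p : ℝ) (f : ℕ → G m → ℂ) : ℝ≥0∞ :=
  (∫⁻ x, (⨆ n, ‖f n x‖ₑ) ^ p ∂haar m) ^ (1 / p)

/-- Membership in the martingale Hardy space `H_p`. -/
def MemHardy (m : ℕ → ℕ) (p : ℝ) (f : ℕ → G m → ℂ) : Prop :=
  Martingale f (filtration m) (haar m) ∧ hardyNorm m p f < ∞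

/-- The Hardy quasi-norm of a function, i.e. of the martingale of its conditional expectations. -/
noncomputable def hardyNormFun (m : ℕ → ℕ) (p : ℝ) (g : G m → ℂ) : ℝ≥0∞ :=
  hardyNorm m p fun n => (haar m)[g | filtration m n]

/-- The quasi-norm of the weak Lebesgue space. -/
noncomputable def weakNorm (m : ℕ → ℕ) (p : ℝ) (g : G m → ℂ) : ℝ≥0∞ :=
  (⨆ (t : ℝ) (_ : 0 < t), ENNReal.ofReal (t ^ p) * haar m {x | t < ‖g x‖}) ^ (1 / p)

/-- The Vilenkin-Fourier coefficients of a martingale (the sequence under the limit is eventually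
constant when `f` is a martingale). -/
noncomputable def coeff (m : ℕ → ℕ) (f : ℕ → G m → ℂ) (i : ℕ) : ℂ :=
  limUnder atTop fun k => ∫ x, f k x * (starRingEnd ℂ) (psi m i x) ∂haar m

/-- The partial sums `S_n f` of the Vilenkin-Fourier series. -/
noncomputable def partialSum (m : ℕ → ℕ) (n : ℕ) (f : ℕ → G m → ℂ) (x : G m) : ℂ :=
  ∑ k ∈ Finset.range n, coeff m f k * psi m k x

/-- The Fejér means `σ_n f = (S_1 f + ... + S_n f) / n`. -/
noncomputable def fejer (m : ℕ → ℕ) (n : ℕ) (f : ℕ → G m → ℂ) (x : G m) : ℂ :=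
  (1 / (n : ℂ)) * ∑ k ∈ Finset.Icc 1 n, partialSum m k f x

end Vilenkin

/-!
The operator `σ_{M_n + 1}` splits into a harmless part and one Vilenkin term.

Multiplying the Vilenkin coefficients of a function by the `s`-th digit of their index is a linear
combination of the translations by `a` in the coordinate `s` (`sum_digitCoeff_mul_psi`, the finite
Fourier expansion of the identity on `0, …, m_s - 1`). As `i = ∑ i_s M_s`, the weights of the Fejér
mean give
`σ_{M_n + 1} f = f⁽ⁿ⁾ - ∑_{s < n} M_s / (M_n + 1) ∑_a κ_{s,a} f⁽ⁿ⁾(· + a e_s)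
  + f^(M_n) ψ_{M_n} / (M_n + 1)`
with bounded `κ` (`fejer_M_succ`). Conditional expectations commute with translations, so the
maximal function of the smooth part (everything but the last term) is at most
`F + C ∑_{s < n} 2^{-(n - s)} ∑_a F(· + a e_s)`, where `F` is the maximal function of `f`. The
`p`-subadditivity of `∫ |·| ^ p` and the invariance of the measure bound its `p`-norm by that of
`F`, uniformly in `n`; no atomic decomposition is needed.

The last term has constant modulus. A function of `n + 1` coordinates is constant on atoms of mass
`1 / M_{n+1}`, so `|f^(M_n)| ≤ M_{n+1}^{1/p - 1} ‖f‖_{H_p}` (`enorm_coeff_M_rpow_le`); this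
produces the factor `M_n^{1/p - 2}` of the upper estimate.

For the sharpness let `D_{M_n}` be `M_n` times the indicator of the interval of rank `n` around `0`,
and let `f = ∑ b_n M_n^{1/p - 1} (D_{M_{n+1}} - D_{M_n})` with `∑ b_n ^ p < ∞`, which makes `f` an
element of `H_p`. The last term of `σ_{M_n + 1} f` then has modulus about `b_n M_n^{1/p - 2}`, while
the smooth parts stay bounded in `L_p`. If `M_n^{1/p - 2} / Φ(n)` is unbounded, a lacunary `b` keeps
`b_n M_n^{1/p - 2} / Φ(n)` unbounded, and Chebyshev's inequality shows that the last term dominates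
on half of the group (`weakNorm_fejer_unbounded`). The choice `Φ = 1` excludes uniform boundedness.
-/

namespace Vilenkin

variable {m : ℕ → ℕ}

/-! ### The generalized number system -/

theorem M_pos [∀ n, NeZero (m n)] (n : ℕ) : 0 < M m n := by
  induction n with
  | zero => exact Nat.one_pos
  | succ n ih => exact Nat.mul_pos (Nat.pos_of_ne_zero (NeZero.ne _)) ih

theorem two_pow_mul_M_le (hm : ∀ n, 2 ≤ m n) (n k : ℕ) : 2 ^ k * M m n ≤ M m (n + k) := by
  induction k with
  | zero => simp
  | succ k ih =>
    calc 2 ^ (k + 1) * M m n = 2 * (2 ^ k * M m n) := by ring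
      _ ≤ m (n + k) * M m (n + k) := Nat.mul_le_mul (hm _) ih

theorem M_mono [∀ n, NeZero (m n)] : Monotone (M m) :=
  monotone_nat_of_le_succ fun _ => Nat.le_mul_of_pos_left _ (Nat.pos_of_ne_zero (NeZero.ne _))

theorem M_lt_M_succ (hm : ∀ n, 2 ≤ m n) (n : ℕ) : M m n < M m (n + 1) := by
  have : ∀ n, NeZero (m n) := fun n => ⟨by have := hm n; omega⟩
  exact lt_mul_of_one_lt_left (M_pos n) (hm n)

theorem M_dvd_M {k n : ℕ} (h : k ≤ n) : M m k ∣ M m n := by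
  induction n, h using Nat.le_induction with
  | base => exact dvd_rfl
  | succ n _ ih => exact ih.mul_left _

theorem digit_eq_zero [∀ n, NeZero (m n)] {i k n : ℕ} (hi : i < M m n) (hk : n ≤ k) :
    digit m i k = 0 := by
  rw [digit, Nat.div_eq_of_lt (hi.trans_le (M_mono hk)), Nat.zero_mod]

theorem digit_lt [∀ n, NeZero (m n)] (i k : ℕ) : digit m i k < m k :=
  Nat.mod_lt _ (Nat.pos_of_ne_zero (NeZero.ne _))

theorem mod_M_eq_sum_digit (i n : ℕ) : i % M m n = ∑ k ∈ Finset.range n, M m k * digit m i k := by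
  induction n with
  | zero => simp [M, Nat.mod_one]
  | succ n ih => rw [Finset.sum_range_succ, ← ih, M, mul_comm, Nat.mod_mul, digit]

theorem digit_add_mul_of_lt {r j k n : ℕ} [∀ n, NeZero (m n)] (hk : k < n) :
    digit m (r + M m n * j) k = digit m r k := by
  obtain ⟨c, hc⟩ := M_dvd_M (m := m) (Nat.succ_le_of_lt hk)
  have h : r + M m n * j = r + M m k * (m k * (c * j)) := by
    rw [hc, M]; ring
  rw [digit, h, Nat.add_mul_div_left _ _ (M_pos k), Nat.add_mul_mod_self_left, digit]

theorem digit_add_mul_self {r j n : ℕ} [∀ n, NeZero (m n)] (hr : r < M m n) (hj : j < m n) :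
    digit m (r + M m n * j) n = j := by
  rw [digit, Nat.add_mul_div_left _ _ (M_pos n), Nat.div_eq_of_lt hr, zero_add, Nat.mod_eq_of_lt hj]

theorem add_mul_lt_M_succ {r j n : ℕ} (hr : r < M m n) (hj : j < m n) :
    r + M m n * j < M m (n + 1) := by
  calc r + M m n * j < M m n + M m n * j := by omega
    _ = (j + 1) * M m n := by ring
    _ ≤ m n * M m n := Nat.mul_le_mul_right _ hj

/-! ### The Vilenkin functions -/

section Characters

variable [∀ n, NeZero (m n)]

theorem rademacher_eq_stdAddChar (k : ℕ) (x : G m) :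
    rademacher m k x = ZMod.stdAddChar (x k) := by
  rw [ZMod.stdAddChar_apply, ZMod.toCircle_apply, rademacher]

theorem psi_eq_prod {i n : ℕ} (hi : i < M m n) (x : G m) :
    psi m i x = ∏ k ∈ Finset.range n, (ZMod.stdAddChar (x k) : ℂ) ^ digit m i k := by
  simp only [← rademacher_eq_stdAddChar]
  refine finprod_eq_prod_of_mulSupport_subset _ fun k hk => ?_
  by_contra h
  have h : n ≤ k := by simpa using h
  exact hk (by simp [digit_eq_zero hi h])

theorem psi_add {i n : ℕ} (hi : i < M m n) (x y : G m) :
    psi m i (x + y) = psi m i x * psi m i y := by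
  simp only [psi_eq_prod hi, Pi.add_apply, AddChar.map_add_eq_mul, mul_pow,
    Finset.prod_mul_distrib]

theorem norm_psi {i n : ℕ} (hi : i < M m n) (x : G m) : ‖psi m i x‖ = 1 := by
  simp [psi_eq_prod hi, norm_prod, AddChar.norm_apply]

theorem conj_psi {i n : ℕ} (hi : i < M m n) (x : G m) :
    (starRingEnd ℂ) (psi m i x) = psi m i (-x) := by
  simp [psi_eq_prod hi, map_prod, AddChar.map_neg_eq_conj]

theorem psi_congr {i n : ℕ} (hi : i < M m n) {x y : G m} (h : ∀ k < n, y k = x k) :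
    psi m i y = psi m i x := by
  rw [psi_eq_prod hi, psi_eq_prod hi]
  exact Finset.prod_congr rfl fun k hk => by rw [h k (Finset.mem_range.mp hk)]

theorem psi_add_mul {r j n : ℕ} (hr : r < M m n) (hj : j < m n) (x : G m) :
    psi m (r + M m n * j) x = psi m r x * (ZMod.stdAddChar (x n) : ℂ) ^ j := by
  rw [psi_eq_prod (add_mul_lt_M_succ hr hj), psi_eq_prod hr, Finset.prod_range_succ,
    digit_add_mul_self hr hj]
  congr 1
  exact Finset.prod_congr rfl fun k hk => by rw [digit_add_mul_of_lt (Finset.mem_range.mp hk)]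

theorem psi_M (hm : ∀ n, 2 ≤ m n) (n : ℕ) (x : G m) : psi m (M m n) x = ZMod.stdAddChar (x n) := by
  have h := psi_add_mul (r := 0) (j := 1) (M_pos n) (hm n) x
  simpa [psi, digit] using h

theorem psi_add_single {i n s : ℕ} (hi : i < M m n) (hs : s < n) (x : G m) (a : ZMod (m s)) :
    psi m i (x + Pi.single s a) = psi m i x * (ZMod.stdAddChar a : ℂ) ^ digit m i s := by
  rw [psi_add hi, psi_eq_prod hi (Pi.single s a),
    Finset.prod_eq_single_of_mem s (Finset.mem_range.mpr hs), Pi.single_eq_same]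
  intro k _ hk
  simp [Pi.single_eq_of_ne hk]

/-- The Dirichlet kernel of order `M n` is `M n` times the indicator of the interval around `0`. -/
theorem sum_psi (n : ℕ) (x : G m) :
    ∑ i ∈ Finset.range (M m n), psi m i x = if ∀ k < n, x k = 0 then (M m n : ℂ) else 0 := by
  induction n with
  | zero => simp [M, psi, digit]
  | succ n ih =>
    have hsplit : ∑ i ∈ Finset.range (M m (n + 1)), psi m i x =
        (∑ i ∈ Finset.range (M m n), psi m i x) *
          ∑ j ∈ Finset.range (m n), (ZMod.stdAddChar (x n) : ℂ) ^ j := by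
      rw [Finset.sum_mul_sum, Finset.sum_comm, Finset.sum_range, M,
        ← finProdFinEquiv.sum_comp, Fintype.sum_prod_type, Finset.sum_range]
      refine Finset.sum_congr rfl fun j _ => ?_
      rw [Finset.sum_range]
      refine Finset.sum_congr rfl fun r _ => ?_
      rw [← psi_add_mul r.2 j.2]
      rfl
    rw [hsplit, ih]
    by_cases hx : x n = 0
    · have : (∀ k < n + 1, x k = 0) ↔ ∀ k < n, x k = 0 := by
        simp only [Nat.lt_succ_iff_lt_or_eq]
        exact ⟨fun h k hk => h k (Or.inl hk), fun h k hk => hk.elim (h k) (fun e => e ▸ hx)⟩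
      simp only [hx, AddChar.map_zero_eq_one, one_pow, this]
      simp [M, mul_comm]
    · have hne : (ZMod.stdAddChar (x n) : ℂ) - 1 ≠ 0 := by
        rw [sub_ne_zero]
        intro h
        exact hx (ZMod.injective_stdAddChar (by rw [h, AddChar.map_zero_eq_one]))
      have hgeom : ∑ j ∈ Finset.range (m n), (ZMod.stdAddChar (x n) : ℂ) ^ j = 0 := by
        have h := mul_geom_sum (ZMod.stdAddChar (x n) : ℂ) (m n)
        rw [← AddChar.map_nsmul_eq_pow, nsmul_eq_mul, ZMod.natCast_self, zero_mul,
          AddChar.map_zero_eq_one, sub_self] at h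
        exact (mul_eq_zero.mp h).resolve_left hne
      rw [hgeom, mul_zero, if_neg fun h => hx (h n n.lt_succ_self)]

/-- The coefficients `κ a` of the finite Fourier expansion `j = ∑ a, κ a * exp (2 π i a j / k)`
of the identity on `0 ≤ j < k`. -/
noncomputable def digitCoeff (k : ℕ) [NeZero k] (a : ZMod k) : ℂ :=
  (k : ℂ)⁻¹ * ∑ l ∈ Finset.range k, (l : ℂ) * ZMod.stdAddChar (-(a * (l : ZMod k)))

theorem norm_digitCoeff_le (k : ℕ) [NeZero k] (a : ZMod k) : ‖digitCoeff k a‖ ≤ k := by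
  have hk : (0 : ℝ) < k := Nat.cast_pos.mpr (Nat.pos_of_ne_zero (NeZero.ne k))
  have h : ‖∑ l ∈ Finset.range k, (l : ℂ) * (ZMod.stdAddChar (-(a * (l : ZMod k))) : ℂ)‖ ≤
      k * k := by
    refine (norm_sum_le_of_le (f := _) (n := fun _ => (k : ℝ)) _ fun l hl => ?_).trans (by simp)
    have : l ≤ k := (Finset.mem_range.mp hl).le
    simpa [AddChar.norm_apply] using this
  rw [digitCoeff, norm_mul, norm_inv, Complex.norm_natCast]
  calc (k : ℝ)⁻¹ * _ ≤ (k : ℝ)⁻¹ * (k * k) := by gcongr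
    _ = k := by field_simp

theorem sum_digitCoeff_mul (k : ℕ) [NeZero k] {j : ℕ} (hj : j < k) :
    ∑ a : ZMod k, digitCoeff k a * (ZMod.stdAddChar a : ℂ) ^ j = j := by
  have hk : (k : ℂ) ≠ 0 := Nat.cast_ne_zero.mpr (NeZero.ne k)
  have hterm : ∀ a : ZMod k, digitCoeff k a * (ZMod.stdAddChar a : ℂ) ^ j =
      (k : ℂ)⁻¹ * ∑ l ∈ Finset.range k,
        (l : ℂ) * ZMod.stdAddChar (a * ((j : ZMod k) - (l : ZMod k))) := by
    intro a
    rw [digitCoeff, mul_assoc, Finset.sum_mul]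
    congr 1
    refine Finset.sum_congr rfl fun l _ => ?_
    rw [← AddChar.map_nsmul_eq_pow, mul_assoc, ← AddChar.map_add_eq_mul, nsmul_eq_mul]
    congr 2
    ring
  simp_rw [hterm]
  rw [← Finset.mul_sum, Finset.sum_comm]
  simp_rw [← Finset.mul_sum, AddChar.sum_mulShift _ (ZMod.isPrimitive_stdAddChar k), sub_eq_zero]
  rw [Finset.sum_eq_single_of_mem j (Finset.mem_range.mpr hj)]
  · simp only [if_true, ZMod.card]
    field_simp
  · intro l hl hlj
    rw [if_neg, Nat.cast_zero, mul_zero]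
    rw [ZMod.natCast_eq_natCast_iff', Nat.mod_eq_of_lt hj,
      Nat.mod_eq_of_lt (Finset.mem_range.mp hl)]
    exact fun h => hlj h.symm

/-- Multiplication of the Vilenkin coefficients by a digit of the index is a combination of
translations in one coordinate. -/
theorem sum_digitCoeff_mul_psi {i n s : ℕ} (hi : i < M m n) (hs : s < n) (x : G m) :
    ∑ a : ZMod (m s), digitCoeff (m s) a * psi m i (x + Pi.single s a) =
      digit m i s * psi m i x := by
  rw [← sum_digitCoeff_mul (m s) (digit_lt i s), Finset.sum_mul]
  exact Finset.sum_congr rfl fun a _ => by rw [psi_add_single hi hs]; ring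

end Characters

/-! ### The measure, translations and the filtration -/

section Measure

/-- Translation by `z` on the group. -/
def translation (z : G m) : G m ≃ᵐ G m where
  toEquiv := Equiv.addRight z
  measurable_toFun := measurable_pi_lambda _ fun k =>
    (measurable_from_top (f := fun a : ZMod (m k) => a + z k)).comp (measurable_pi_apply k)
  measurable_invFun := measurable_pi_lambda _ fun k =>
    (measurable_from_top (f := fun a : ZMod (m k) => a + -z k)).comp (measurable_pi_apply k)

@[simp] theorem translation_apply (z x : G m) : translation z x = x + z := rfl

theorem preimage_translation_interval (n : ℕ) (z x : G m) :
    translation z ⁻¹' interval m n x = interval m n (x - z) := by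
  ext y
  simp [interval, eq_sub_iff_add_eq]

theorem measurableSet_filtration_preimage_translation {n : ℕ} (z : G m) {s : Set (G m)}
    (hs : MeasurableSet[filtration m n] s) :
    MeasurableSet[filtration m n] (translation z ⁻¹' s) := by
  have : MeasurableSpace.generateFrom (Set.range (interval m n)) ≤
      MeasurableSpace.map (translation z) (filtration m n) := by
    refine MeasurableSpace.generateFrom_le ?_
    rintro _ ⟨x, rfl⟩
    change MeasurableSet[filtration m n] (translation z ⁻¹' interval m n x)
    rw [preimage_translation_interval]
    exact MeasurableSpace.measurableSet_generateFrom ⟨_, rfl⟩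
  exact this s hs

/-- A set of the `n`-th σ-algebra is a union of intervals of rank `n`. -/
theorem mem_iff_of_measurableSet_filtration {n : ℕ} {s : Set (G m)}
    (hs : MeasurableSet[filtration m n] s) {x y : G m} (h : ∀ k < n, y k = x k) :
    y ∈ s ↔ x ∈ s := by
  refine MeasurableSpace.generateFrom_induction (Set.range (interval m n))
    (fun s _ => (y ∈ s ↔ x ∈ s)) ?_ (by simp) ?_ ?_ s hs
  · rintro _ ⟨z, rfl⟩ _
    simp only [interval, Set.mem_ofPred_eq]
    exact forall₂_congr fun k hk => by rw [h k hk]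
  · intro t _ ht
    simp [ht]
  · intro t _ ht
    simp [ht]

theorem eq_of_stronglyMeasurable_filtration {n : ℕ} {g : G m → ℂ}
    (hg : StronglyMeasurable[filtration m n] g) {x y : G m} (h : ∀ k < n, y k = x k) :
    g y = g x :=
  (mem_iff_of_measurableSet_filtration (hg.measurable (measurableSet_singleton (g x))) h).mpr rfl

theorem countable_range_interval (n : ℕ) : (Set.range (interval m n)).Countable := by
  have := fun k => countable_zmod (m k)
  refine Set.Countable.mono ?_
    (Set.countable_range fun z : (∀ k : Fin n, ZMod (m k)) => {y : G m | ∀ k : Fin n, y k = z k})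
  rintro _ ⟨x, rfl⟩
  refine ⟨fun k => x k, ?_⟩
  ext y
  simp only [interval, Set.mem_ofPred_eq]
  exact ⟨fun h k hk => h ⟨k, hk⟩, fun h k => h k k.2⟩

/-- Functions of the first `n` coordinates are measurable for the `n`-th σ-algebra, because there
are only countably many intervals of rank `n`. -/
theorem stronglyMeasurable_filtration {n : ℕ} {g : G m → ℂ}
    (h : ∀ x y : G m, (∀ k < n, y k = x k) → g y = g x) :
    StronglyMeasurable[filtration m n] g := by
  suffices Measurable[filtration m n] g from this.stronglyMeasurable
  intro s _
  have hU : g ⁻¹' s = ⋃₀ {I ∈ Set.range (interval m n) | I ⊆ g ⁻¹' s} := by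
    ext x
    simp only [Set.mem_sUnion]
    refine ⟨fun hx => ⟨interval m n x, ⟨⟨x, rfl⟩, fun y hy => ?_⟩, fun k _ => rfl⟩,
      fun ⟨I, hI, hxI⟩ => hI.2 hxI⟩
    rw [Set.mem_preimage, h x y hy]
    exact hx
  rw [hU]
  exact @MeasurableSet.sUnion _ (filtration m n) _
    ((countable_range_interval n).mono fun _ hI => hI.1)
    fun I hI => MeasurableSpace.measurableSet_generateFrom hI.1

variable [∀ n, NeZero (m n)]

instance isProbabilityMeasure_uniform (k : ℕ) [NeZero k] :
    IsProbabilityMeasure ((k : ℝ≥0∞)⁻¹ • Measure.count : Measure (ZMod k)) := by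
  constructor
  rw [Measure.smul_apply, Measure.count_apply MeasurableSet.univ, smul_eq_mul]
  simp only [ENat.card_eq_coe_fintype_card, Set.encard_univ, ZMod.card]
  exact ENNReal.inv_mul_cancel (by simpa using NeZero.ne k) (by simp)

instance : IsProbabilityMeasure (haar m) := by
  unfold haar; infer_instance

theorem haar_interval (n : ℕ) (x : G m) : haar m (interval m n x) = (M m n : ℝ≥0∞)⁻¹ := by
  have h : interval m n x = Set.pi (Finset.range n : Finset ℕ) fun k => {x k} := by
    ext y; simp [interval, Set.mem_pi]
  rw [h, haar, Measure.infinitePi_pi _ fun k _ => MeasurableSpace.measurableSet_top]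
  have : ∀ k ∈ Finset.range n, (((m k : ℝ≥0∞)⁻¹ • Measure.count : Measure (ZMod (m k))) {x k})
      = (m k : ℝ≥0∞)⁻¹ := by
    intro k _
    rw [Measure.smul_apply, Measure.count_apply MeasurableSpace.measurableSet_top]
    simp
  rw [Finset.prod_congr rfl this]
  clear h this
  induction n with
  | zero => simp [M]
  | succ n ih =>
    rw [Finset.prod_range_succ, ih, M, Nat.cast_mul, mul_comm,
      ENNReal.mul_inv (Or.inr (by simp)) (Or.inl (by simp))]

theorem measurePreserving_translation (z : G m) :
    MeasurePreserving (translation z) (haar m) (haar m) := by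
  refine ⟨(translation z).measurable, ?_⟩
  have h := Measure.infinitePi_map_pi
    (fun n => ((m n : ℝ≥0∞)⁻¹ • Measure.count : Measure (ZMod (m n))))
    (f := fun n a => a + z n) (fun n => measurable_from_top)
  unfold haar
  refine h.trans ?_
  congr 1
  funext n
  rw [Measure.map_smul]
  congr 1
  ext s hs
  rw [Measure.map_apply measurable_from_top hs, Measure.count_apply hs,
    Measure.count_apply MeasurableSpace.measurableSet_top]
  exact congrArg _ (Set.encard_preimage_of_bijective (Equiv.addRight (z n)).bijective s)

end Measure

/-! ### Vilenkin expansion of a function of finitely many coordinates -/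

section Adapted

variable [∀ n, NeZero (m n)]

theorem stronglyMeasurable_psi {i n : ℕ} (hi : i < M m n) :
    StronglyMeasurable[filtration m n] (psi m i) :=
  stronglyMeasurable_filtration fun _ _ h => psi_congr hi h

theorem integrable_psi {i n : ℕ} (hi : i < M m n) : Integrable (psi m i) (haar m) :=
  Integrable.of_bound
    ((stronglyMeasurable_psi hi).mono ((filtration m).le n)).aestronglyMeasurable 1
    (ae_of_all _ fun x => (norm_psi hi x).le)

theorem integrable_mul_conj_psi {i n : ℕ} (hi : i < M m n) {g : G m → ℂ}
    (hg : Integrable g (haar m)) :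
    Integrable (fun x => g x * (starRingEnd ℂ) (psi m i x)) (haar m) :=
  hg.mul_bdd (c := 1)
    (continuous_star.comp_aestronglyMeasurable (integrable_psi hi).aestronglyMeasurable)
    (ae_of_all _ fun x => by simp [norm_psi hi x])

/-- A function of the first `n` coordinates equals its partial sum of order `M n`. -/
theorem eq_sum_integral_mul_psi {n : ℕ} {g : G m → ℂ}
    (hg : StronglyMeasurable[filtration m n] g) (hgi : Integrable g (haar m)) (x : G m) :
    g x = ∑ i ∈ Finset.range (M m n),
      (∫ y, g y * (starRingEnd ℂ) (psi m i y) ∂haar m) * psi m i x := by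
  have hM : (M m n : ℂ) ≠ 0 := Nat.cast_ne_zero.mpr (M_pos n).ne'
  simp_rw [← integral_mul_const]
  rw [← integral_finsetSum _ fun i hi =>
    (integrable_mul_conj_psi (Finset.mem_range.mp hi) hgi).mul_const _]
  have key : ∀ y, ∑ i ∈ Finset.range (M m n), g y * (starRingEnd ℂ) (psi m i y) * psi m i x =
      (interval m n x).indicator (fun _ => g x * (M m n : ℂ)) y := by
    intro y
    have h1 : ∀ i ∈ Finset.range (M m n), g y * (starRingEnd ℂ) (psi m i y) * psi m i x =
        g y * psi m i (x - y) := by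
      intro i hi
      rw [conj_psi (Finset.mem_range.mp hi), sub_eq_add_neg, psi_add (Finset.mem_range.mp hi)]
      ring
    rw [Finset.sum_congr rfl h1, ← Finset.mul_sum, sum_psi]
    by_cases hy : y ∈ interval m n x
    · rw [Set.indicator_of_mem hy, if_pos fun k hk => ?_,
        eq_of_stronglyMeasurable_filtration hg hy]
      rw [Pi.sub_apply, hy k hk, sub_self]
    · rw [Set.indicator_of_notMem hy, if_neg, mul_zero]
      exact fun h => hy fun k hk => (sub_eq_zero.mp (h k hk)).symm
  simp_rw [key]
  rw [integral_indicator_const _ (measurableSet_interval m n x), Measure.real, haar_interval]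
  simp only [ENNReal.toReal_inv, ENNReal.toReal_natCast, Complex.real_smul]
  push_cast
  field_simp

end Adapted

/-! ### Maximal functions and subadditivity of powers -/

section Maximal

theorem sum_partialSum (f : ℕ → G m → ℂ) (n : ℕ) (x : G m) :
    ∑ k ∈ Finset.Icc 1 n, partialSum m k f x =
      n * partialSum m n f x - ∑ i ∈ Finset.range n, (i : ℂ) * (coeff m f i * psi m i x) := by
  induction n with
  | zero => simp
  | succ n ih =>
    rw [Finset.sum_Icc_succ_top (by omega), ih, Finset.sum_range_succ]
    simp only [partialSum, Finset.sum_range_succ]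
    push_cast
    ring

/-- The maximal function of a sequence of functions. -/
noncomputable def maximal (f : ℕ → G m → ℂ) (x : G m) : ℝ≥0∞ := ⨆ n, ‖f n x‖ₑ

theorem le_maximal (f : ℕ → G m → ℂ) (n : ℕ) (x : G m) : ‖f n x‖ₑ ≤ maximal f x :=
  le_iSup (fun n => ‖f n x‖ₑ) n

theorem measurable_martingale {f : ℕ → G m → ℂ} (hf : Martingale f (filtration m) (haar m))
    (n : ℕ) : Measurable (f n) :=
  ((hf.1 n).mono ((filtration m).le n)).measurable

theorem measurable_maximal {f : ℕ → G m → ℂ} (hf : Martingale f (filtration m) (haar m)) :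
    Measurable (maximal f) :=
  Measurable.iSup fun n => (measurable_martingale hf n).enorm

theorem rpow_sum_le_sum_rpow {ι : Type*} (s : Finset ι) (g : ι → ℝ≥0∞) {p : ℝ} (hp0 : 0 < p)
    (hp1 : p ≤ 1) : (∑ i ∈ s, g i) ^ p ≤ ∑ i ∈ s, g i ^ p :=
  Finset.le_sum_of_subadditive (fun x : ℝ≥0∞ => x ^ p) (by simp [ENNReal.zero_rpow_of_pos hp0])
    (fun x y => ENNReal.rpow_add_le_add_rpow x y hp0.le hp1) s g

theorem measurable_comp_add {F : G m → ℝ≥0∞} (hF : Measurable F) (z : G m) :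
    Measurable fun x => F (x + z) :=
  hF.comp (translation z).measurable

end Maximal

/-! ### The Fejér mean of a martingale -/

section Martingales

variable [∀ n, NeZero (m n)]

theorem condExp_comp_translation (n : ℕ) (z : G m) {g : G m → ℂ} (hg : Integrable g (haar m)) :
    (haar m)[fun x => g (x + z) | filtration m n] =ᵐ[haar m]
      fun x => ((haar m)[g | filtration m n]) (x + z) := by
  have hmp := measurePreserving_translation z
  have hgz : Integrable (fun x => g (x + z)) (haar m) := hmp.integrable_comp_of_integrable hg
  have hEz : Integrable (fun x => ((haar m)[g | filtration m n]) (x + z)) (haar m) :=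
    hmp.integrable_comp_of_integrable integrable_condExp
  refine (ae_eq_condExp_of_forall_setIntegral_eq ((filtration m).le n) hgz
    (fun s _ _ => hEz.integrableOn) (fun s hs _ => ?_) ?_).symm
  · have hs' : MeasurableSet[filtration m n] (translation (-z) ⁻¹' s) :=
      measurableSet_filtration_preimage_translation _ hs
    have hss : s = translation z ⁻¹' (translation (-z) ⁻¹' s) := by
      ext x; simp
    rw [hss]
    have h1 := hmp.setIntegral_preimage_emb (translation z).measurableEmbedding
      ((haar m)[g | filtration m n]) (translation (-z) ⁻¹' s)
    have h2 := hmp.setIntegral_preimage_emb (translation z).measurableEmbedding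
      g (translation (-z) ⁻¹' s)
    simp only [translation_apply] at h1 h2
    rw [h1, h2, setIntegral_condExp ((filtration m).le n) hg hs']
  · refine (stronglyMeasurable_filtration fun x y h =>
      eq_of_stronglyMeasurable_filtration stronglyMeasurable_condExp
        fun k hk => ?_).aestronglyMeasurable
    simp [h k hk]

variable {f : ℕ → G m → ℂ}

theorem integral_mul_conj_psi_of_le (hf : Martingale f (filtration m) (haar m)) {i n N : ℕ}
    (hi : i < M m n) (hN : n ≤ N) :
    ∫ x, f N x * (starRingEnd ℂ) (psi m i x) ∂haar m =
      ∫ x, f n x * (starRingEnd ℂ) (psi m i x) ∂haar m := by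
  have hmeas : StronglyMeasurable[filtration m n] fun x => (starRingEnd ℂ) (psi m i x) :=
    continuous_star.comp_stronglyMeasurable (stronglyMeasurable_psi hi)
  have h := condExp_bilin_of_stronglyMeasurable_right (μ := haar m)
    (ContinuousLinearMap.mul ℝ ℂ) hmeas (integrable_mul_conj_psi hi (hf.integrable N))
    (hf.integrable N)
  rw [← integral_condExp ((filtration m).le n)]
  refine integral_congr_ae ?_
  filter_upwards [h, hf.2 n N hN] with x hx hx'
  simp only [ContinuousLinearMap.mul_apply'] at hx
  rw [hx, hx']

theorem coeff_eq_integral (hf : Martingale f (filtration m) (haar m)) {i n : ℕ}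
    (hi : i < M m n) :
    coeff m f i = ∫ x, f n x * (starRingEnd ℂ) (psi m i x) ∂haar m := by
  refine Tendsto.limUnder_eq (tendsto_const_nhds.congr' ?_)
  filter_upwards [eventually_ge_atTop n] with N hN
  exact (integral_mul_conj_psi_of_le hf hi hN).symm

theorem partialSum_M (hf : Martingale f (filtration m) (haar m)) (n : ℕ) (x : G m) :
    partialSum m (M m n) f x = f n x := by
  rw [eq_sum_integral_mul_psi (hf.1 n) (hf.integrable n) x, partialSum]
  exact Finset.sum_congr rfl fun i hi => by rw [coeff_eq_integral hf (Finset.mem_range.mp hi)]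

/-- The one-coordinate translations that occur in the Fejér mean of order `M n + 1`: a pair
`⟨s, a⟩` stands for adding `a` to the coordinate `s < n`. -/
def shifts (m : ℕ → ℕ) [∀ n, NeZero (m n)] (n : ℕ) : Finset (Σ s, ZMod (m s)) :=
  (Finset.range n).sigma fun _ => Finset.univ

/-- The Fejér mean of order `M n + 1`, without its last Vilenkin term, as a combination of
translates of `g`. -/
noncomputable def smoothPart (m : ℕ → ℕ) [∀ n, NeZero (m n)] (n : ℕ) (g : G m → ℂ) (x : G m) :
    ℂ :=
  g x - ∑ j ∈ shifts m n,
    ((M m j.1 : ℂ) / ((M m n : ℂ) + 1) * digitCoeff (m j.1) j.2) * g (x + Pi.single j.1 j.2)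

/-- The index is the combination of its digits with weights `M s`, and each digit acts on the
coefficients through translations in one coordinate. -/
theorem sum_mul_coeff_psi (hf : Martingale f (filtration m) (haar m)) (n : ℕ) (x : G m) :
    ∑ i ∈ Finset.range (M m n), (i : ℂ) * (coeff m f i * psi m i x) =
      ∑ j ∈ shifts m n,
        ((M m j.1 : ℂ) * digitCoeff (m j.1) j.2) * f n (x + Pi.single j.1 j.2) := by
  have h1 : ∀ i ∈ Finset.range (M m n), (i : ℂ) * (coeff m f i * psi m i x) =
      ∑ s ∈ Finset.range n, ∑ a : ZMod (m s), (M m s : ℂ) * digitCoeff (m s) a *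
        (coeff m f i * psi m i (x + Pi.single s a)) := by
    intro i hi
    have hi := Finset.mem_range.mp hi
    have hsum := mod_M_eq_sum_digit (m := m) i n
    rw [Nat.mod_eq_of_lt hi] at hsum
    have hsum : (i : ℂ) = ∑ s ∈ Finset.range n, (M m s : ℂ) * digit m i s := by
      exact_mod_cast hsum
    conv_lhs => rw [hsum, Finset.sum_mul]
    refine Finset.sum_congr rfl fun s hs => ?_
    have h := sum_digitCoeff_mul_psi hi (Finset.mem_range.mp hs) x
    calc (M m s : ℂ) * digit m i s * (coeff m f i * psi m i x)
        = (M m s : ℂ) * coeff m f i * (digit m i s * psi m i x) := by ring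
      _ = _ := by
        rw [← h, Finset.mul_sum]
        exact Finset.sum_congr rfl fun a _ => by ring
  rw [Finset.sum_congr rfl h1, Finset.sum_comm, shifts, Finset.sum_sigma]
  refine Finset.sum_congr rfl fun s _ => ?_
  rw [Finset.sum_comm]
  refine Finset.sum_congr rfl fun a _ => ?_
  rw [← Finset.mul_sum, ← partialSum_M hf n, partialSum]

/-- The only part of the Fejér mean of order `M n + 1` whose size is not controlled by the
maximal function is its last Vilenkin term. -/
theorem fejer_M_succ (hf : Martingale f (filtration m) (haar m)) (n : ℕ) (x : G m) :
    fejer m (M m n + 1) f x = smoothPart m n (f n) x +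
      coeff m f (M m n) / ((M m n : ℂ) + 1) * psi m (M m n) x := by
  have hM : (M m n : ℂ) + 1 ≠ 0 := by exact_mod_cast (M m n).succ_ne_zero
  have hshift : ∑ j ∈ shifts m n, ((M m j.1 : ℂ) / ((M m n : ℂ) + 1) * digitCoeff (m j.1) j.2) *
      f n (x + Pi.single j.1 j.2) = ((M m n : ℂ) + 1)⁻¹ * ∑ j ∈ shifts m n,
        ((M m j.1 : ℂ) * digitCoeff (m j.1) j.2) * f n (x + Pi.single j.1 j.2) := by
    rw [Finset.mul_sum]
    exact Finset.sum_congr rfl fun j _ => by ring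
  rw [fejer, sum_partialSum, smoothPart, hshift, ← sum_mul_coeff_psi hf, Finset.sum_range_succ,
    partialSum, Finset.sum_range_succ, ← partialSum, partialSum_M hf]
  push_cast
  field_simp
  ring

theorem condExp_martingale (hf : Martingale f (filtration m) (haar m)) (N n : ℕ) :
    (haar m)[f n | filtration m N] =ᵐ[haar m] f (min N n) := by
  rcases le_total N n with h | h
  · rw [min_eq_left h]
    exact hf.2 N n h
  · rw [min_eq_right h, condExp_of_stronglyMeasurable ((filtration m).le N)
      ((hf.1 n).mono ((filtration m).mono h)) (hf.integrable n)]

theorem integrable_comp_add {g : G m → ℂ} (hg : Integrable g (haar m)) (z : G m) :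
    Integrable (fun x => g (x + z)) (haar m) :=
  (measurePreserving_translation z).integrable_comp_of_integrable hg

theorem ae_comp_add {P : G m → Prop} (h : ∀ᵐ x ∂haar m, P x) (z : G m) :
    ∀ᵐ x ∂haar m, P (x + z) :=
  (measurePreserving_translation z).quasiMeasurePreserving.ae h

theorem integrable_smoothPart {g : G m → ℂ} (hg : Integrable g (haar m)) (n : ℕ) :
    Integrable (smoothPart m n g) (haar m) :=
  hg.sub (integrable_finsetSum _ fun _ _ => (integrable_comp_add hg _).const_mul _)

theorem condExp_smoothPart (hf : Martingale f (filtration m) (haar m)) (N n : ℕ) :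
    (haar m)[smoothPart m n (f n) | filtration m N] =ᵐ[haar m]
      smoothPart m n (f (min N n)) := by
  let c : (Σ s, ZMod (m s)) → ℂ :=
    fun j => (M m j.1 : ℂ) / ((M m n : ℂ) + 1) * digitCoeff (m j.1) j.2
  have hint : ∀ j : Σ s, ZMod (m s), Integrable
      (c j • fun x => f n (x + Pi.single j.1 j.2)) (haar m) :=
    fun j => (integrable_comp_add (hf.integrable n) _).smul (c j)
  have hfun : smoothPart m n (f n) =
      f n - ∑ j ∈ shifts m n, c j • fun x => f n (x + Pi.single j.1 j.2) := by
    ext x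
    simp [smoothPart, c, Finset.sum_apply]
  have hterm : ∀ᵐ x ∂haar m, ∀ j ∈ shifts m n,
      ((haar m)[c j • fun x => f n (x + Pi.single j.1 j.2) | filtration m N]) x =
        c j * f (min N n) (x + Pi.single j.1 j.2) := by
    refine (ae_ball_iff (shifts m n).countable_toSet).mpr fun j _ => ?_
    filter_upwards [condExp_smul (μ := haar m) (c j) (fun x => f n (x + Pi.single j.1 j.2))
      (filtration m N), condExp_comp_translation N (Pi.single j.1 j.2) (hf.integrable n),
      ae_comp_add (condExp_martingale hf N n) (Pi.single j.1 j.2)] with x h1 h2 h3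
    rw [h1, Pi.smul_apply, h2, h3, smul_eq_mul]
  rw [hfun]
  filter_upwards [condExp_sub (hf.integrable n)
    (integrable_finsetSum' (shifts m n) fun j _ => hint j) (filtration m N),
    condExp_finsetSum (s := shifts m n) (fun j _ => hint j) (filtration m N),
    condExp_martingale hf N n, hterm] with x h1 h2 h3 h4
  rw [h1, Pi.sub_apply, h2, h3, Finset.sum_apply, smoothPart, Finset.sum_congr rfl h4]

theorem norm_condExp_psi_le {i n : ℕ} (hi : i < M m n) (N : ℕ) :
    ∀ᵐ x ∂haar m, ‖((haar m)[psi m i | filtration m N]) x‖ ≤ 1 := by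
  have h : (fun x => ‖psi m i x‖) = fun _ => (1 : ℝ) := funext fun x => norm_psi hi x
  have h' := norm_condExp_le (μ := haar m) (m := filtration m N) (psi m i)
  rw [h, condExp_const ((filtration m).le N)] at h'
  exact h'

end Martingales

/-! ### Bounds in the `p`-norm -/

section Majorants

variable [∀ n, NeZero (m n)]

/-- A pointwise bound of `smoothPart m n g` in terms of a bound `F` of `g`. -/
noncomputable def majorant (B n : ℕ) (F : G m → ℝ≥0∞) (x : G m) : ℝ≥0∞ :=
  F x + ∑ j ∈ shifts m n, ((B : ℝ≥0∞) * 2⁻¹ ^ (n - j.1)) * F (x + Pi.single j.1 j.2)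

theorem enorm_smoothPart_le (hm : ∀ n, 2 ≤ m n) {B : ℕ} (hB : ∀ n, m n ≤ B) {g : G m → ℂ}
    {F : G m → ℝ≥0∞} (h : ∀ x, ‖g x‖ₑ ≤ F x) (n : ℕ) (x : G m) :
    ‖smoothPart m n g x‖ₑ ≤ majorant B n F x := by
  refine enorm_sub_le.trans (add_le_add (h x) ((enorm_sum_le _ _).trans
    (Finset.sum_le_sum fun j hj => ?_)))
  rw [enorm_mul]
  refine mul_le_mul' ?_ (h _)
  have hj : j.1 < n := by simpa [shifts] using hj
  have hpow := two_pow_mul_M_le hm j.1 (n - j.1)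
  rw [Nat.add_sub_cancel' hj.le] at hpow
  have hpow : (2 : ℝ) ^ (n - j.1) * M m j.1 ≤ M m n := by exact_mod_cast hpow
  have hreal : ‖(M m j.1 : ℂ) / ((M m n : ℂ) + 1) * digitCoeff (m j.1) j.2‖ ≤
      B * (2⁻¹ : ℝ) ^ (n - j.1) := by
    have hn : ‖(M m n : ℂ) + 1‖ = (M m n : ℝ) + 1 := by
      exact_mod_cast Complex.norm_natCast (M m n + 1)
    rw [norm_mul, norm_div, hn, Complex.norm_natCast, mul_comm]
    refine mul_le_mul ((norm_digitCoeff_le _ _).trans (Nat.cast_le.mpr (hB _))) ?_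
      (by positivity) (by positivity)
    rw [inv_pow, div_le_iff₀ (by positivity), le_inv_mul_iff₀ (by positivity)]
    linarith
  calc ‖(M m j.1 : ℂ) / ((M m n : ℂ) + 1) * digitCoeff (m j.1) j.2‖ₑ
      ≤ ENNReal.ofReal (B * (2⁻¹ : ℝ) ^ (n - j.1)) := by
        rw [← ofReal_norm]
        exact ENNReal.ofReal_le_ofReal hreal
    _ = _ := by
        rw [ENNReal.ofReal_mul (by positivity), ENNReal.ofReal_pow (by positivity),
          ENNReal.ofReal_inv_of_pos two_pos, ENNReal.ofReal_natCast, ENNReal.ofReal_ofNat]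

/-- The constant in the `p`-norm bound of `majorant`. -/
noncomputable def majorantConst (B : ℕ) (p : ℝ) : ℝ≥0∞ :=
  1 + (B : ℝ≥0∞) * (B : ℝ≥0∞) ^ p * (1 - 2⁻¹ ^ p)⁻¹

theorem majorantConst_ne_top (B : ℕ) {p : ℝ} (hp0 : 0 < p) : majorantConst B p ≠ ∞ := by
  have h : (2⁻¹ : ℝ≥0∞) ^ p < 1 := ENNReal.rpow_lt_one (by simp) hp0
  refine ENNReal.add_ne_top.mpr ⟨ENNReal.one_ne_top, ENNReal.mul_ne_top (ENNReal.mul_ne_top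
    (ENNReal.natCast_ne_top B)
    (ENNReal.rpow_ne_top_of_nonneg hp0.le (ENNReal.natCast_ne_top B))) ?_⟩
  exact ENNReal.inv_ne_top.mpr (tsub_pos_of_lt h).ne'

theorem measurable_majorant {F : G m → ℝ≥0∞} (hF : Measurable F) (B n : ℕ) :
    Measurable (majorant B n F) :=
  hF.add (Finset.measurable_fun_sum _ fun _ _ => (measurable_comp_add hF _).const_mul _)

theorem sum_pow_sub_le (ρ : ℝ≥0∞) (n : ℕ) :
    ∑ s ∈ Finset.range n, ρ ^ (n - s) ≤ (1 - ρ)⁻¹ := by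
  have h := Finset.sum_range_reflect (fun k => ρ ^ k) (n + 1)
  calc ∑ s ∈ Finset.range n, ρ ^ (n - s)
      ≤ ∑ s ∈ Finset.range (n + 1), ρ ^ (n - s) :=
        Finset.sum_le_sum_of_subset (Finset.range_mono n.le_succ)
    _ = ∑ s ∈ Finset.range (n + 1), ρ ^ s := by simpa using h
    _ ≤ ∑' k, ρ ^ k := ENNReal.sum_le_tsum _
    _ = _ := ENNReal.tsum_geometric _

theorem lintegral_comp_add_rpow {F : G m → ℝ≥0∞} (hF : Measurable F) (p : ℝ) (z : G m) :
    ∫⁻ x, F (x + z) ^ p ∂haar m = ∫⁻ x, F x ^ p ∂haar m :=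
  (measurePreserving_translation z).lintegral_comp (hF.pow_const p)

theorem majorant_rpow_le (B n : ℕ) (F : G m → ℝ≥0∞) {p : ℝ} (hp0 : 0 < p) (hp1 : p ≤ 1)
    (x : G m) :
    majorant B n F x ^ p ≤ F x ^ p + ∑ j ∈ shifts m n,
      ((B : ℝ≥0∞) * 2⁻¹ ^ (n - j.1)) ^ p * F (x + Pi.single j.1 j.2) ^ p := by
  refine (ENNReal.rpow_add_le_add_rpow _ _ hp0.le hp1).trans (add_le_add le_rfl
    ((rpow_sum_le_sum_rpow _ _ hp0 hp1).trans_eq ?_))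
  exact Finset.sum_congr rfl fun j _ => ENNReal.mul_rpow_of_nonneg _ _ hp0.le

theorem sum_shifts_rpow_le {B : ℕ} (hB : ∀ n, m n ≤ B) {p : ℝ} (hp0 : 0 < p) (n : ℕ) :
    ∑ j ∈ shifts m n, ((B : ℝ≥0∞) * 2⁻¹ ^ (n - j.1)) ^ p ≤
      (B : ℝ≥0∞) * (B : ℝ≥0∞) ^ p * (1 - 2⁻¹ ^ p)⁻¹ := by
  have hterm : ∀ s ∈ Finset.range n, ∑ _a : ZMod (m s), ((B : ℝ≥0∞) * 2⁻¹ ^ (n - s)) ^ p ≤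
      (B : ℝ≥0∞) * (B : ℝ≥0∞) ^ p * ((2⁻¹ : ℝ≥0∞) ^ p) ^ (n - s) := by
    intro s _
    rw [Finset.sum_const, Finset.card_univ, ZMod.card, nsmul_eq_mul,
      ENNReal.mul_rpow_of_nonneg _ _ hp0.le, ← ENNReal.rpow_natCast, ← ENNReal.rpow_natCast,
      ← ENNReal.rpow_mul, ← ENNReal.rpow_mul, mul_comm p, ← mul_assoc]
    gcongr
    exact hB s
  rw [shifts, Finset.sum_sigma]
  refine (Finset.sum_le_sum hterm).trans ?_
  rw [← Finset.mul_sum]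
  gcongr
  exact sum_pow_sub_le _ n

theorem lintegral_majorant_rpow_le {B : ℕ} (hB : ∀ n, m n ≤ B) {F : G m → ℝ≥0∞}
    (hF : Measurable F) {p : ℝ} (hp0 : 0 < p) (hp1 : p ≤ 1) (n : ℕ) :
    ∫⁻ x, majorant B n F x ^ p ∂haar m ≤ majorantConst B p * ∫⁻ x, F x ^ p ∂haar m := by
  refine (lintegral_mono (majorant_rpow_le B n F hp0 hp1)).trans ?_
  rw [lintegral_add_left (hF.pow_const p), lintegral_finsetSum _ fun j _ =>
    ((measurable_comp_add hF _).pow_const p).const_mul _]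
  simp_rw [lintegral_const_mul _ ((measurable_comp_add hF _).pow_const p),
    lintegral_comp_add_rpow hF]
  rw [← Finset.sum_mul, majorantConst, add_mul, one_mul]
  gcongr
  exact sum_shifts_rpow_le hB hp0 n

/-- The `p`-th power of an `F_n`-measurable function is, on each of its atoms, at most `M n` times
its integral; hence its `1`-norm is controlled by its `p`-norm. -/
theorem lintegral_enorm_rpow_le {n : ℕ} {g : G m → ℂ} (hg : StronglyMeasurable[filtration m n] g)
    {p : ℝ} (hp0 : 0 < p) (hp1 : p ≤ 1) :
    (∫⁻ x, ‖g x‖ₑ ∂haar m) ^ p ≤ (M m n : ℝ≥0∞) ^ (1 - p) * ∫⁻ x, ‖g x‖ₑ ^ p ∂haar m := by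
  have hmeas : Measurable g := (hg.mono ((filtration m).le n)).measurable
  set H := ∫⁻ x, ‖g x‖ₑ ^ p ∂haar m with hH
  have hMtop : (M m n : ℝ≥0∞) ≠ ∞ := ENNReal.natCast_ne_top _
  have hM0 : (M m n : ℝ≥0∞) ≠ 0 := Nat.cast_ne_zero.mpr (M_pos n).ne'
  -- `g` is constant on `interval m n x`, which has measure `1 / M n`.
  have hsup : ∀ x, ‖g x‖ₑ ^ p ≤ M m n * H := by
    intro x
    have h : ∫⁻ y in interval m n x, ‖g y‖ₑ ^ p ∂haar m = ‖g x‖ₑ ^ p * (M m n : ℝ≥0∞)⁻¹ := by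
      rw [setLIntegral_congr_fun (g := fun _ => ‖g x‖ₑ ^ p) (measurableSet_interval m n x)
        (fun y hy => by simp only [eq_of_stronglyMeasurable_filtration hg hy]),
        setLIntegral_const, haar_interval]
    have h' : ‖g x‖ₑ ^ p * (M m n : ℝ≥0∞)⁻¹ ≤ H := h ▸ setLIntegral_le_lintegral _ _
    rw [← ENNReal.div_eq_inv_mul.trans (mul_comm _ _), ENNReal.div_le_iff hM0 hMtop] at h'
    rwa [mul_comm]
  have hpt : ∀ x, ‖g x‖ₑ ≤ (M m n * H) ^ ((1 - p) / p) * ‖g x‖ₑ ^ p := by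
    intro x
    calc ‖g x‖ₑ = ‖g x‖ₑ ^ (1 - p + p) := by simp
      _ = (‖g x‖ₑ ^ p) ^ ((1 - p) / p) * ‖g x‖ₑ ^ p := by
          rw [ENNReal.rpow_add_of_nonneg _ _ (by linarith) hp0.le, ← ENNReal.rpow_mul]
          congr 2
          field_simp
      _ ≤ _ := by
          have : 0 ≤ (1 - p) / p := div_nonneg (by linarith) hp0.le
          gcongr
          exact hsup x
  calc (∫⁻ x, ‖g x‖ₑ ∂haar m) ^ p
      ≤ ((M m n * H) ^ ((1 - p) / p) * H) ^ p := by
        gcongr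
        exact (lintegral_mono hpt).trans_eq
          (lintegral_const_mul _ (hmeas.enorm.pow_const p))
    _ = (M m n : ℝ≥0∞) ^ (1 - p) * (H ^ (1 - p) * H ^ p) := by
        rw [ENNReal.mul_rpow_of_nonneg _ _ hp0.le, ← ENNReal.rpow_mul, div_mul_cancel₀ _ hp0.ne',
          ENNReal.mul_rpow_of_nonneg _ _ (by linarith : 0 ≤ 1 - p), mul_assoc]
    _ = (M m n : ℝ≥0∞) ^ (1 - p) * H := by
        rw [← ENNReal.rpow_add_of_nonneg _ _ (by linarith) hp0.le]
        simp

theorem enorm_coeff_M_rpow_le (hm : ∀ n, 2 ≤ m n) {f : ℕ → G m → ℂ}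
    (hf : Martingale f (filtration m) (haar m)) {p : ℝ} (hp0 : 0 < p) (hp1 : p ≤ 1) (n : ℕ) :
    ‖coeff m f (M m n)‖ₑ ^ p ≤
      (M m (n + 1) : ℝ≥0∞) ^ (1 - p) * ∫⁻ x, maximal f x ^ p ∂haar m := by
  have hlt := M_lt_M_succ hm n
  rw [coeff_eq_integral hf hlt]
  calc _ ≤ (∫⁻ x, ‖f (n + 1) x‖ₑ ∂haar m) ^ p := by
        gcongr
        refine (enorm_integral_le_lintegral_enorm _).trans_eq (lintegral_congr fun x => ?_)
        rw [enorm_mul, ← ofReal_norm ((starRingEnd ℂ) _), RCLike.norm_conj, norm_psi hlt]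
        simp
    _ ≤ _ := lintegral_enorm_rpow_le (hf.1 _) hp0 hp1
    _ ≤ _ := by
        gcongr with x
        exact le_maximal f _ x

end Majorants

/-! ### The upper estimate -/

section UpperBound

variable [∀ n, NeZero (m n)]

theorem iSup_enorm_condExp_fejer_le (hm : ∀ n, 2 ≤ m n) {B : ℕ} (hB : ∀ n, m n ≤ B)
    {f : ℕ → G m → ℂ} (hf : Martingale f (filtration m) (haar m)) (n : ℕ) :
    ∀ᵐ x ∂haar m, ⨆ N, ‖((haar m)[fejer m (M m n + 1) f | filtration m N]) x‖ₑ ≤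
      majorant B n (maximal f) x + ‖coeff m f (M m n)‖ₑ * (M m n : ℝ≥0∞)⁻¹ := by
  have hlt := M_lt_M_succ hm n
  set c : ℂ := coeff m f (M m n) / ((M m n : ℂ) + 1) with hc
  have hfun : fejer m (M m n + 1) f = smoothPart m n (f n) + c • psi m (M m n) :=
    funext fun x => fejer_M_succ hf n x
  have hcn : ‖c‖ₑ ≤ ‖coeff m f (M m n)‖ₑ * (M m n : ℝ≥0∞)⁻¹ := by
    have hpos : (0 : ℝ) < M m n := Nat.cast_pos.mpr (M_pos n)
    have h : ‖c‖ ≤ ‖coeff m f (M m n)‖ * (M m n : ℝ)⁻¹ := by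
      have hn : ‖(M m n : ℂ) + 1‖ = (M m n : ℝ) + 1 := by
        exact_mod_cast Complex.norm_natCast (M m n + 1)
      rw [hc, norm_div, hn, div_eq_mul_inv]
      gcongr
      linarith
    rw [← ofReal_norm, ← ofReal_norm]
    refine (ENNReal.ofReal_le_ofReal h).trans_eq ?_
    rw [ENNReal.ofReal_mul (norm_nonneg _), ENNReal.ofReal_inv_of_pos hpos, ENNReal.ofReal_natCast]
  have hN : ∀ N, ∀ᵐ x ∂haar m, ‖((haar m)[fejer m (M m n + 1) f | filtration m N]) x‖ₑ ≤
      majorant B n (maximal f) x + ‖coeff m f (M m n)‖ₑ * (M m n : ℝ≥0∞)⁻¹ := by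
    intro N
    rw [hfun]
    filter_upwards [condExp_add (integrable_smoothPart (hf.integrable n) n)
      ((integrable_psi hlt).smul c) (filtration m N), condExp_smoothPart hf N n,
      condExp_smul (μ := haar m) c (psi m (M m n)) (filtration m N),
      norm_condExp_psi_le hlt N] with x h1 h2 h3 h4
    rw [h1, Pi.add_apply, h2, h3, Pi.smul_apply, smul_eq_mul]
    refine (enorm_add_le _ _).trans (add_le_add
      (enorm_smoothPart_le hm hB (fun y => le_maximal f _ y) n x) ?_)
    rw [enorm_mul]
    refine (mul_le_of_le_one_right' ?_).trans hcn
    rw [← ofReal_norm]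
    exact ENNReal.ofReal_le_one.mpr h4
  filter_upwards [ae_all_iff.mpr hN] with x hx
  exact iSup_le hx

/-- The smooth part contributes a bounded factor, the last Vilenkin term the factor
`M n ^ (1 / p - 2)`. -/
theorem hardyNormFun_fejer_le (hm : ∀ n, 2 ≤ m n) {B : ℕ} (hB : ∀ n, m n ≤ B) {p : ℝ}
    (hp0 : 0 < p) (hp : p < 1 / 2) {f : ℕ → G m → ℂ}
    (hf : Martingale f (filtration m) (haar m)) (n : ℕ) :
    hardyNormFun m p (fejer m (M m n + 1) f) ≤
      (majorantConst B p + (B : ℝ≥0∞) ^ (1 - p)) ^ (1 / p) *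
        ENNReal.ofReal ((M m n : ℝ) ^ (1 / p - 2)) * hardyNorm m p f := by
  have hp1 : p ≤ 1 := by linarith
  have hMpos : (0 : ℝ) < M m n := Nat.cast_pos.mpr (M_pos n)
  have hMtop : (M m n : ℝ≥0∞) ≠ ∞ := ENNReal.natCast_ne_top _
  have hM0 : (M m n : ℝ≥0∞) ≠ 0 := Nat.cast_ne_zero.mpr (M_pos n).ne'
  have hM1 : (1 : ℝ≥0∞) ≤ M m n := Nat.one_le_cast.mpr (M_pos n)
  set H := ∫⁻ x, maximal f x ^ p ∂haar m with hH
  have hcoeff : (‖coeff m f (M m n)‖ₑ * (M m n : ℝ≥0∞)⁻¹) ^ p ≤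
      (B : ℝ≥0∞) ^ (1 - p) * (M m n : ℝ≥0∞) ^ (1 - 2 * p) * H := by
    rw [ENNReal.mul_rpow_of_nonneg _ _ hp0.le]
    calc _ ≤ ((M m (n + 1) : ℝ≥0∞) ^ (1 - p) * H) * (M m n : ℝ≥0∞)⁻¹ ^ p := by
          gcongr
          exact enorm_coeff_M_rpow_le hm hf hp0 hp1 n
      _ ≤ (((B : ℝ≥0∞) * M m n) ^ (1 - p) * H) * (M m n : ℝ≥0∞)⁻¹ ^ p := by
          have : 0 ≤ 1 - p := by linarith
          have : M m (n + 1) ≤ B * M m n := Nat.mul_le_mul_right _ (hB n)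
          gcongr
          exact_mod_cast this
      _ = (B : ℝ≥0∞) ^ (1 - p) * ((M m n : ℝ≥0∞) ^ (1 - p) * (M m n : ℝ≥0∞) ^ (-p)) * H := by
          rw [ENNReal.mul_rpow_of_nonneg _ _ (by linarith), ENNReal.inv_rpow, ENNReal.rpow_neg]
          ring
      _ = _ := by
          rw [← ENNReal.rpow_add _ _ hM0 hMtop]
          congr 3
          ring
  have hmain : ∫⁻ x, (⨆ N, ‖((haar m)[fejer m (M m n + 1) f | filtration m N]) x‖ₑ) ^ p ∂haar m ≤
      (majorantConst B p + (B : ℝ≥0∞) ^ (1 - p)) * (M m n : ℝ≥0∞) ^ (1 - 2 * p) * H := by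
    calc _ ≤ ∫⁻ x, majorant B n (maximal f) x ^ p +
            (‖coeff m f (M m n)‖ₑ * (M m n : ℝ≥0∞)⁻¹) ^ p ∂haar m := by
          refine lintegral_mono_ae ?_
          filter_upwards [iSup_enorm_condExp_fejer_le hm hB hf n] with x hx
          exact (ENNReal.rpow_le_rpow hx hp0.le).trans
            (ENNReal.rpow_add_le_add_rpow _ _ hp0.le hp1)
      _ ≤ majorantConst B p * H + (B : ℝ≥0∞) ^ (1 - p) * (M m n : ℝ≥0∞) ^ (1 - 2 * p) * H := by
          rw [lintegral_add_right _ measurable_const, lintegral_const, measure_univ, mul_one]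
          exact add_le_add (lintegral_majorant_rpow_le hB (measurable_maximal hf) hp0 hp1 n) hcoeff
      _ ≤ majorantConst B p * (M m n : ℝ≥0∞) ^ (1 - 2 * p) * H +
            (B : ℝ≥0∞) ^ (1 - p) * (M m n : ℝ≥0∞) ^ (1 - 2 * p) * H := by
          gcongr
          exact le_mul_of_one_le_right' (ENNReal.one_le_rpow hM1 (by linarith))
      _ = _ := by ring
  rw [hardyNormFun, hardyNorm, hardyNorm]
  refine (ENNReal.rpow_le_rpow hmain (by positivity)).trans_eq ?_
  rw [ENNReal.mul_rpow_of_nonneg _ _ (by positivity),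
    ENNReal.mul_rpow_of_nonneg _ _ (by positivity),
    ← ENNReal.rpow_mul, ← ENNReal.ofReal_rpow_of_pos hMpos, ENNReal.ofReal_natCast]
  congr 3
  field_simp

end UpperBound

/-! ### Martingales built from differences of Dirichlet kernels -/

section Blocks

/-- The difference of the Dirichlet kernels of orders `M (n + 1)` and `M n`. -/
noncomputable def block (m : ℕ → ℕ) (n : ℕ) (x : G m) : ℂ :=
  (interval m (n + 1) 0).indicator (fun _ => (M m (n + 1) : ℂ)) x -
    (interval m n 0).indicator (fun _ => (M m n : ℂ)) x

/-- The partial sums of the series with terms `w n * block n`; they form a martingale. -/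
noncomputable def blockSum (m : ℕ → ℕ) (w : ℕ → ℝ) (N : ℕ) (x : G m) : ℂ :=
  ∑ n ∈ Finset.range N, (w n : ℂ) * block m n x

theorem interval_zero_congr {n N : ℕ} (hn : n ≤ N) {x y : G m} (h : ∀ k < N, y k = x k) :
    y ∈ interval m n 0 ↔ x ∈ interval m n 0 :=
  forall₂_congr fun k hk => by rw [h k (hk.trans_le hn)]

theorem indicator_interval_congr {n N : ℕ} (hn : n ≤ N) (c : ℂ) {x y : G m}
    (h : ∀ k < N, y k = x k) :
    (interval m n 0).indicator (fun _ => c) y = (interval m n 0).indicator (fun _ => c) x := by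
  by_cases hx : x ∈ interval m n 0
  · rw [Set.indicator_of_mem hx, Set.indicator_of_mem ((interval_zero_congr hn h).mpr hx)]
  · rw [Set.indicator_of_notMem hx, Set.indicator_of_notMem (mt (interval_zero_congr hn h).mp hx)]

theorem block_congr {n N : ℕ} (hn : n < N) {x y : G m} (h : ∀ k < N, y k = x k) :
    block m n y = block m n x := by
  rw [block, block, indicator_interval_congr hn _ h, indicator_interval_congr hn.le _ h]

theorem stronglyMeasurable_blockSum (w : ℕ → ℝ) (N : ℕ) :
    StronglyMeasurable[filtration m N] (blockSum m w N) :=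
  stronglyMeasurable_filtration fun _ _ h => Finset.sum_congr rfl fun n hn => by
    rw [block_congr (Finset.mem_range.mp hn) h]

theorem block_eq_zero {n : ℕ} {x : G m} (hx : x ∉ interval m n 0) : block m n x = 0 := by
  have hx' : x ∉ interval m (n + 1) 0 := fun h => hx fun k hk => h k (hk.trans n.lt_succ_self)
  rw [block, Set.indicator_of_notMem hx, Set.indicator_of_notMem hx', sub_zero]

variable [∀ n, NeZero (m n)]

theorem enorm_block_le (n : ℕ) (x : G m) :
    ‖block m n x‖ₑ ≤ (interval m n 0).indicator (fun _ => (M m (n + 1) : ℝ≥0∞)) x := by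
  by_cases hx : x ∈ interval m n 0
  · have hle : (M m n : ℝ) ≤ M m (n + 1) := Nat.cast_le.mpr (M_mono n.le_succ)
    have h : ‖block m n x‖ ≤ M m (n + 1) := by
      rw [block, Set.indicator_of_mem hx]
      by_cases hx' : x ∈ interval m (n + 1) 0
      · rw [Set.indicator_of_mem hx', ← Complex.ofReal_natCast, ← Complex.ofReal_natCast,
          ← Complex.ofReal_sub, Complex.norm_real, Real.norm_of_nonneg (by linarith)]
        linarith [(M m n).cast_nonneg (α := ℝ)]
      · rw [Set.indicator_of_notMem hx', zero_sub, norm_neg, Complex.norm_natCast]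
        exact hle
    rw [Set.indicator_of_mem hx, ← ofReal_norm, ← ENNReal.ofReal_natCast]
    exact ENNReal.ofReal_le_ofReal h
  · simp [block_eq_zero hx]

theorem integrable_indicator_interval (n : ℕ) (c : ℂ) :
    Integrable ((interval m n 0).indicator fun _ => c) (haar m) :=
  (integrable_const c).indicator (measurableSet_interval m n 0)

theorem integrable_block (n : ℕ) : Integrable (block m n) (haar m) :=
  (integrable_indicator_interval _ _).sub (integrable_indicator_interval _ _)

theorem integral_indicator_interval (n : ℕ) :
    ∫ x, (interval m n 0).indicator (fun _ => (M m n : ℂ)) x ∂haar m = 1 := by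
  have hM : (M m n : ℂ) ≠ 0 := Nat.cast_ne_zero.mpr (M_pos n).ne'
  rw [integral_indicator_const _ (measurableSet_interval m n 0), Measure.real, haar_interval]
  simp [hM]

theorem integral_block (n : ℕ) : ∫ x, block m n x ∂haar m = 0 := by
  unfold block
  rw [integral_sub (integrable_indicator_interval _ _) (integrable_indicator_interval _ _),
    integral_indicator_interval, integral_indicator_interval, sub_self]

theorem condExp_block (n : ℕ) : (haar m)[block m n | filtration m n] =ᵐ[haar m] 0 := by
  refine (ae_eq_condExp_of_forall_setIntegral_eq ((filtration m).le n) (integrable_block n)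
    (fun s _ _ => (integrable_zero _ _ _).integrableOn) (fun s hs _ => ?_)
    aestronglyMeasurable_zero).symm
  simp only [Pi.zero_apply, integral_zero]
  -- `interval m n 0`, which carries `block m n`, is an atom: it lies in `s` or misses it.
  by_cases h0 : (0 : G m) ∈ s
  · rw [setIntegral_eq_integral_of_forall_compl_eq_zero fun x hx => ?_, integral_block]
    exact block_eq_zero fun hxI => hx ((mem_iff_of_measurableSet_filtration hs hxI).mpr h0)
  · refine (setIntegral_eq_zero_of_forall_eq_zero fun x hx => ?_).symm
    exact block_eq_zero fun hxI => h0 ((mem_iff_of_measurableSet_filtration hs hxI).mp hx)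

theorem integrable_blockSum (w : ℕ → ℝ) (N : ℕ) : Integrable (blockSum m w N) (haar m) :=
  integrable_finsetSum _ fun n _ => (integrable_block n).const_mul _

theorem martingale_blockSum (w : ℕ → ℝ) :
    Martingale (blockSum m w) (filtration m) (haar m) := by
  refine martingale_nat (stronglyMeasurable_blockSum w) (integrable_blockSum w) fun n => ?_
  have hsplit : blockSum m w (n + 1) = blockSum m w n + (w n : ℂ) • block m n :=
    funext fun x => Finset.sum_range_succ _ _
  rw [hsplit]
  filter_upwards [condExp_add (integrable_blockSum w n) ((integrable_block n).smul (w n : ℂ))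
    (filtration m n), condExp_smul (μ := haar m) (w n : ℂ) (block m n) (filtration m n),
    condExp_block n] with x h1 h2 h3
  rw [h1, Pi.add_apply, h2, Pi.smul_apply, h3, condExp_of_stronglyMeasurable ((filtration m).le n)
    (stronglyMeasurable_blockSum w n) (integrable_blockSum w n)]
  simp

/-- `block m n` is at most `M (n + 1)` and lives on a set of measure `1 / M n`, so its `p`-norm to
the power `p` is of the order `M n ^ (p - 1)`. -/
theorem lintegral_maximal_blockSum_rpow_le {B : ℕ} (hB : ∀ n, m n ≤ B) (w : ℕ → ℝ) {p : ℝ}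
    (hp0 : 0 < p) (hp1 : p ≤ 1) :
    ∫⁻ x, maximal (blockSum m w) x ^ p ∂haar m ≤
      ∑' n, (B : ℝ≥0∞) ^ p * (‖w n‖ₑ ^ p * (M m n : ℝ≥0∞) ^ (p - 1)) := by
  have hpt : ∀ x, maximal (blockSum m w) x ^ p ≤
      ∑' n, ‖w n‖ₑ ^ p * (interval m n 0).indicator (fun _ => (M m (n + 1) : ℝ≥0∞) ^ p) x := by
    intro x
    rw [← ENNReal.le_rpow_inv_iff hp0]
    refine iSup_le fun N => ?_
    rw [ENNReal.le_rpow_inv_iff hp0]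
    calc ‖blockSum m w N x‖ₑ ^ p
        ≤ (∑ n ∈ Finset.range N, ‖(w n : ℂ) * block m n x‖ₑ) ^ p := by
          gcongr
          exact enorm_sum_le _ _
      _ ≤ ∑ n ∈ Finset.range N, ‖(w n : ℂ) * block m n x‖ₑ ^ p :=
          rpow_sum_le_sum_rpow _ _ hp0 hp1
      _ ≤ ∑ n ∈ Finset.range N,
            ‖w n‖ₑ ^ p * (interval m n 0).indicator (fun _ => (M m (n + 1) : ℝ≥0∞) ^ p) x := by
          refine Finset.sum_le_sum fun n _ => ?_
          have hw : ‖(w n : ℂ)‖ₑ = ‖w n‖ₑ := by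
            rw [← ofReal_norm, Complex.norm_real, ofReal_norm]
          rw [enorm_mul, ENNReal.mul_rpow_of_nonneg _ _ hp0.le, hw]
          gcongr
          refine (ENNReal.rpow_le_rpow (enorm_block_le n x) hp0.le).trans_eq ?_
          by_cases hx : x ∈ interval m n 0
          · simp [Set.indicator_of_mem hx]
          · simp [Set.indicator_of_notMem hx, ENNReal.zero_rpow_of_pos hp0]
      _ ≤ _ := ENNReal.sum_le_tsum _
  refine (lintegral_mono hpt).trans ?_
  rw [lintegral_tsum fun n =>
    ((measurable_const.indicator (measurableSet_interval m n 0)).const_mul _).aemeasurable]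
  refine ENNReal.tsum_le_tsum fun n => ?_
  have hM0 : (M m n : ℝ≥0∞) ≠ 0 := Nat.cast_ne_zero.mpr (M_pos n).ne'
  have hle : M m (n + 1) ≤ B * M m n := Nat.mul_le_mul_right _ (hB n)
  rw [lintegral_const_mul _ (measurable_const.indicator (measurableSet_interval m n 0)),
    lintegral_indicator_const (measurableSet_interval m n 0), haar_interval]
  calc ‖w n‖ₑ ^ p * ((M m (n + 1) : ℝ≥0∞) ^ p * (M m n : ℝ≥0∞)⁻¹)
      ≤ ‖w n‖ₑ ^ p * (((B : ℝ≥0∞) * M m n) ^ p * (M m n : ℝ≥0∞)⁻¹) := by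
        gcongr
        exact_mod_cast hle
    _ = _ := by
        rw [ENNReal.mul_rpow_of_nonneg _ _ hp0.le,
          ENNReal.rpow_sub _ _ hM0 (ENNReal.natCast_ne_top _), ENNReal.rpow_one, div_eq_mul_inv]
        ring

/-- The Vilenkin function of index `M n` oscillates in the coordinate `n`, hence is orthogonal to
the functions of the first `n` coordinates. -/
theorem integral_mul_conj_psi_M_eq_zero (hm : ∀ n, 2 ≤ m n) {n : ℕ} {g : G m → ℂ}
    (hg : StronglyMeasurable[filtration m n] g) :
    ∫ x, g x * (starRingEnd ℂ) (psi m (M m n) x) ∂haar m = 0 := by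
  set I := ∫ x, g x * (starRingEnd ℂ) (psi m (M m n) x) ∂haar m with hI
  set ω : ℂ := (starRingEnd ℂ) (ZMod.stdAddChar (1 : ZMod (m n))) with hω
  have hω1 : ω ≠ 1 := by
    intro h
    have h1 : (ZMod.stdAddChar (1 : ZMod (m n)) : ℂ) = ZMod.stdAddChar (0 : ZMod (m n)) := by
      rw [AddChar.map_zero_eq_one, ← Complex.conj_conj (ZMod.stdAddChar (1 : ZMod (m n))), ← hω, h,
        map_one]
    have : Fact (1 < m n) := ⟨hm n⟩
    exact one_ne_zero (ZMod.injective_stdAddChar h1)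
  have hshift : I = I * ω := by
    rw [hI, ← integral_mul_const]
    have h := (measurePreserving_translation (Pi.single n 1 : G m)).integral_comp'
      (fun x => g x * (starRingEnd ℂ) (psi m (M m n) x))
    rw [← h]
    refine integral_congr_ae (ae_of_all _ fun x => ?_)
    have hgx : g (x + Pi.single n 1) = g x :=
      eq_of_stronglyMeasurable_filtration hg fun k hk => by simp [Pi.single_eq_of_ne hk.ne]
    simp only [translation_apply, hgx, psi_M hm, Pi.add_apply, Pi.single_eq_same,
      AddChar.map_add_eq_mul, map_mul, hω]
    ring
  have : I * (ω - 1) = 0 := by rw [mul_sub, mul_one, ← hshift, sub_self]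
  exact (mul_eq_zero.mp this).resolve_right (sub_ne_zero.mpr hω1)

theorem coeff_blockSum (hm : ∀ n, 2 ≤ m n) (w : ℕ → ℝ) (n : ℕ) :
    coeff m (blockSum m w) (M m n) = w n := by
  have hlt := M_lt_M_succ hm n
  rw [coeff_eq_integral (martingale_blockSum w) hlt]
  have hone : ∀ x, (interval m (n + 1) 0).indicator (fun _ => (M m (n + 1) : ℂ)) x *
      (starRingEnd ℂ) (psi m (M m n) x) =
        (interval m (n + 1) 0).indicator (fun _ => (M m (n + 1) : ℂ)) x := by
    intro x
    by_cases hx : x ∈ interval m (n + 1) 0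
    · rw [psi_M hm, hx n n.lt_succ_self]
      simp
    · simp [Set.indicator_of_notMem hx]
  -- All but the leading kernel depend on the first `n` coordinates only.
  have hlow : StronglyMeasurable[filtration m n] fun x => blockSum m w n x -
      w n * (interval m n 0).indicator (fun _ => (M m n : ℂ)) x :=
    stronglyMeasurable_filtration fun x y h => by
      rw [indicator_interval_congr le_rfl _ h,
        eq_of_stronglyMeasurable_filtration (stronglyMeasurable_blockSum w n) h]
  have hsplit : ∀ x, blockSum m w (n + 1) x * (starRingEnd ℂ) (psi m (M m n) x) =
      w n * (interval m (n + 1) 0).indicator (fun _ => (M m (n + 1) : ℂ)) x +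
        (blockSum m w n x - w n * (interval m n 0).indicator (fun _ => (M m n : ℂ)) x) *
          (starRingEnd ℂ) (psi m (M m n) x) := by
    intro x
    rw [← hone x, blockSum, Finset.sum_range_succ, ← blockSum, block]
    ring
  have hlowi : Integrable (fun x => blockSum m w n x -
      w n * (interval m n 0).indicator (fun _ => (M m n : ℂ)) x) (haar m) :=
    (integrable_blockSum w n).sub ((integrable_indicator_interval _ _).const_mul _)
  simp_rw [hsplit]
  rw [integral_add ((integrable_indicator_interval _ _).const_mul _)
    (integrable_mul_conj_psi hlt hlowi),
    integral_mul_conj_psi_M_eq_zero hm hlow, integral_const_mul, integral_indicator_interval]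
  simp

end Blocks

/-! ### Sharpness -/

section LowerBound

/-- A sequence with finite `p`-sum that does not compensate the growth of an unbounded one. -/
theorem exists_summable_mul_unbounded {q : ℕ → ℝ} (hq : ∀ C : ℝ, ∃ᶠ k in atTop, C < q k) {p : ℝ}
    (hp0 : 0 < p) : ∃ b : ℕ → ℝ, (∀ n, 0 ≤ b n) ∧ ∑' n, ENNReal.ofReal (b n) ^ p ≠ ∞ ∧
      ∀ C : ℝ, ∃ᶠ k in atTop, C < b k * q k := by
  -- `b` lives on a sparse sequence `α j`, where `b ^ p = 2 ^ (-j)` and `q` exceeds `j / b`.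
  obtain ⟨α, hα, hαq⟩ := extraction_forall_of_frequently
    fun j : ℕ => hq ((j : ℝ) * (2 : ℝ) ^ ((j : ℝ) / p))
  set e : ℕ → ℝ := fun j => ((2 : ℝ) ^ ((j : ℝ) / p))⁻¹ with he
  refine ⟨Function.extend α e 0, fun n => ?_, ?_, fun C => ?_⟩
  · by_cases h : ∃ j, α j = n
    · obtain ⟨j, rfl⟩ := h
      rw [hα.injective.extend_apply]
      positivity
    · rw [Function.extend_apply' _ _ _ h]
      exact le_rfl
  · have h : ∀ n, ENNReal.ofReal (Function.extend α e 0 n) ^ p =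
        Function.extend α (fun j => (2⁻¹ : ℝ≥0∞) ^ j) 0 n := by
      intro n
      by_cases h : ∃ j, α j = n
      · obtain ⟨j, rfl⟩ := h
        rw [hα.injective.extend_apply, hα.injective.extend_apply, he]
        simp only
        rw [ENNReal.ofReal_inv_of_pos (by positivity), ← ENNReal.ofReal_rpow_of_pos two_pos,
          ENNReal.ofReal_ofNat, ENNReal.inv_rpow, ← ENNReal.rpow_mul, div_mul_cancel₀ _ hp0.ne',
          ENNReal.rpow_natCast, ENNReal.inv_pow]
      · rw [Function.extend_apply' _ _ _ h, Function.extend_apply' _ _ _ h]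
        simp [ENNReal.zero_rpow_of_pos hp0]
    simp_rw [h]
    rw [tsum_extend_zero hα.injective, ENNReal.tsum_geometric]
    simp
  · rw [frequently_atTop]
    intro a
    obtain ⟨j, hj⟩ := exists_nat_gt C
    refine ⟨α (max a j), (le_max_left a j).trans (hα.id_le _), ?_⟩
    rw [hα.injective.extend_apply, he]
    simp only
    rw [← div_eq_inv_mul, lt_div_iff₀ (by positivity)]
    refine lt_of_le_of_lt ?_ (hαq (max a j))
    gcongr
    exact hj.le.trans (Nat.cast_le.mpr (le_max_right a j))

theorem le_weakNorm {p : ℝ} (hp0 : 0 < p) {g : G m → ℂ} {t : ℝ} (ht : 0 < t) {r : ℝ≥0∞}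
    (h : r ^ p ≤ ENNReal.ofReal (t ^ p) * haar m {x | t < ‖g x‖}) : r ≤ weakNorm m p g := by
  rw [weakNorm, one_div, ENNReal.le_rpow_inv_iff hp0]
  exact h.trans (le_iSup₂_of_le t ht le_rfl)

theorem tendsto_M_rpow (hm : ∀ n, 2 ≤ m n) {s : ℝ} (hs : 0 < s) :
    Tendsto (fun k => (M m k : ℝ) ^ s) atTop atTop := by
  refine (tendsto_rpow_atTop hs).comp (tendsto_natCast_atTop_atTop.comp
    (tendsto_atTop_mono (fun k => ?_) tendsto_id))
  exact Nat.lt_two_pow_self.le.trans (by simpa [M] using two_pow_mul_M_le hm 0 k)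

variable [∀ n, NeZero (m n)]

/-- Sharpness of the rate: the last Vilenkin term of the Fejér mean of a suitable block series
dominates the smooth part, whose `p`-norm is bounded, on at least half of the group. -/
theorem weakNorm_fejer_unbounded (hm : ∀ n, 2 ≤ m n) {B : ℕ} (hB : ∀ n, m n ≤ B) {p : ℝ}
    (hp0 : 0 < p) (hp1 : p ≤ 1) {Φ : ℕ → ℝ} (hΦ : Monotone Φ)
    (hq : ∀ C : ℝ, ∃ᶠ k in atTop, C < (M m k : ℝ) ^ (1 / p - 2) / Φ k) :
    ∃ f : ℕ → G m → ℂ, MemHardy m p f ∧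
      ⨆ k : ℕ, weakNorm m p (fun x => fejer m (M m k + 1) f x / (Φ k : ℂ)) = ∞ := by
  obtain ⟨b, hb0, hbsum, hbq⟩ := exists_summable_mul_unbounded hq hp0
  set w : ℕ → ℝ := fun n => b n * (M m n : ℝ) ^ (1 / p - 1) with hw
  set f := blockSum m w with hf
  have hmart : Martingale f (filtration m) (haar m) := martingale_blockSum w
  have hMpos : ∀ n, (0 : ℝ) < M m n := fun n => Nat.cast_pos.mpr (M_pos n)
  set H := ∫⁻ x, maximal f x ^ p ∂haar m with hH
  have hHtop : H ≠ ∞ := by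
    refine ne_top_of_le_ne_top ?_ (lintegral_maximal_blockSum_rpow_le hB w hp0 hp1)
    rw [ENNReal.tsum_mul_left]
    refine ENNReal.mul_ne_top
      (ENNReal.rpow_ne_top_of_nonneg hp0.le (ENNReal.natCast_ne_top B)) ?_
    convert hbsum using 3 with n
    have hM0 : (M m n : ℝ≥0∞) ≠ 0 := Nat.cast_ne_zero.mpr (M_pos n).ne'
    rw [hw, Real.enorm_of_nonneg (mul_nonneg (hb0 n) (by positivity)),
      ENNReal.ofReal_mul (hb0 n), ENNReal.mul_rpow_of_nonneg _ _ hp0.le,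
      ← ENNReal.ofReal_rpow_of_pos (hMpos n), ENNReal.ofReal_natCast, ← ENNReal.rpow_mul,
      mul_assoc, ← ENNReal.rpow_add _ _ hM0 (ENNReal.natCast_ne_top _)]
    have : (1 / p - 1) * p + (p - 1) = 0 := by field_simp; ring
    rw [this, ENNReal.rpow_zero, mul_one]
  refine ⟨f, ⟨hmart, ?_⟩, ?_⟩
  · exact ENNReal.rpow_lt_top_of_nonneg (by positivity) hHtop
  set A := majorantConst B p * H with hA
  have hAtop : A ≠ ∞ := ENNReal.mul_ne_top (majorantConst_ne_top B hp0) hHtop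
  -- `Φ` is positive from `k₀` on, which excludes quotients by zero there.
  obtain ⟨k₀, hk₀⟩ := (hq 0).exists
  have hδ : 0 < Φ k₀ := by
    by_contra h
    exact hk₀.not_ge (div_nonpos_of_nonneg_of_nonpos (by positivity) (not_lt.mp h))
  refine ENNReal.eq_top_of_forall_nnreal_le fun r => ?_
  -- `T` makes the smooth part at most `T * Φ k` on half of the group, and is large enough for `r`.
  obtain ⟨T, hT0, hTA, hTr⟩ : ∃ T : ℝ, 0 < T ∧ 2 * A ≤ ENNReal.ofReal (T * Φ k₀) ^ p ∧
      (r : ℝ≥0∞) ^ p ≤ ENNReal.ofReal (T ^ p) * 2⁻¹ := by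
    refine ⟨1 + ((2 * A) ^ p⁻¹).toReal / Φ k₀ + r * 2 ^ p⁻¹, by positivity, ?_, ?_⟩
    · have h2A : (2 * A) ^ p⁻¹ ≠ ∞ := ENNReal.rpow_ne_top_of_nonneg (by positivity)
        (ENNReal.mul_ne_top (by simp) hAtop)
      rw [← ENNReal.rpow_inv_le_iff hp0]
      refine (ENNReal.ofReal_toReal h2A).symm.le.trans (ENNReal.ofReal_le_ofReal ?_)
      rw [← div_le_iff₀ hδ]
      have : (0 : ℝ) ≤ r * 2 ^ p⁻¹ := by positivity
      linarith
    · have h : (r : ℝ) ^ p * 2 ≤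
          (1 + ((2 * A) ^ p⁻¹).toReal / Φ k₀ + r * 2 ^ p⁻¹) ^ p := by
        calc (r : ℝ) ^ p * 2 = (r * 2 ^ p⁻¹) ^ p := by
              rw [Real.mul_rpow (by positivity) (by positivity), ← Real.rpow_mul two_pos.le,
                inv_mul_cancel₀ hp0.ne', Real.rpow_one]
          _ ≤ _ := by
              gcongr
              have : 0 ≤ ((2 * A) ^ p⁻¹).toReal / Φ k₀ := by positivity
              linarith
      rw [← div_eq_mul_inv, ENNReal.le_div_iff_mul_le (by simp) (by simp)]
      refine le_trans (le_of_eq ?_) (ENNReal.ofReal_le_ofReal h)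
      rw [ENNReal.ofReal_mul (by positivity), ENNReal.ofReal_ofNat,
        ← ENNReal.ofReal_rpow_of_nonneg (NNReal.coe_nonneg r) hp0.le, ENNReal.ofReal_coe_nnreal]
  obtain ⟨k, hk, hkq⟩ := (frequently_atTop.mp (hbq (4 * T))) k₀
  have hΦk : 0 < Φ k := hδ.trans_le (hΦ hk)
  refine le_iSup_of_le k (le_weakNorm hp0 hT0 (hTr.trans ?_))
  gcongr
  set c : ℝ≥0∞ := ENNReal.ofReal (T * Φ k) with hc
  have hcpos : 0 < c := ENNReal.ofReal_pos.mpr (mul_pos hT0 hΦk)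
  have hlarge : haar m {x | c ≤ majorant B k (maximal f) x} ≤ 2⁻¹ := by
    have hset : {x | c ≤ majorant B k (maximal f) x} ⊆
        {x | c ^ p ≤ majorant B k (maximal f) x ^ p} :=
      fun x hx => ENNReal.rpow_le_rpow hx hp0.le
    refine (measure_mono hset).trans ((meas_ge_le_lintegral_div
      ((measurable_majorant (measurable_maximal hmart) B k).pow_const p).aemeasurable
      (ENNReal.rpow_pos hcpos ENNReal.ofReal_ne_top).ne'
      (ENNReal.rpow_ne_top_of_nonneg hp0.le ENNReal.ofReal_ne_top)).trans ?_)
    refine ENNReal.div_le_of_le_mul ?_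
    refine (lintegral_majorant_rpow_le hB (measurable_maximal hmart) hp0 hp1 k).trans ?_
    have hAc : 2 * A ≤ c ^ p := hTA.trans (by
      refine ENNReal.rpow_le_rpow (ENNReal.ofReal_le_ofReal ?_) hp0.le
      exact mul_le_mul_of_nonneg_left (hΦ hk) hT0.le)
    calc A = 2⁻¹ * (2 * A) := by
          rw [← mul_assoc, ENNReal.inv_mul_cancel (by simp) (by simp), one_mul]
      _ ≤ 2⁻¹ * c ^ p := by gcongr
  have hsmall : {x | c ≤ majorant B k (maximal f) x}ᶜ ⊆
      {x | T < ‖fejer m (M m k + 1) f x / (Φ k : ℂ)‖} := by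
    intro x hx
    have hx : majorant B k (maximal f) x < c := not_le.mp hx
    have hs : ‖smoothPart m k (f k) x‖ < T * Φ k := by
      have h := (enorm_smoothPart_le hm hB (fun y => le_maximal f k y) k x).trans_lt hx
      rw [← ofReal_norm, hc] at h
      exact (ENNReal.ofReal_lt_ofReal_iff (mul_pos hT0 hΦk)).mp h
    set z : ℂ := coeff m f (M m k) / ((M m k : ℂ) + 1) * psi m (M m k) x with hz
    have hznorm : 2 * T * Φ k ≤ ‖z‖ := by
      have hn : ‖(M m k : ℂ) + 1‖ = (M m k : ℝ) + 1 := by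
        exact_mod_cast Complex.norm_natCast (M m k + 1)
      have hM1 : (1 : ℝ) ≤ M m k := Nat.one_le_cast.mpr (M_pos k)
      rw [hz, norm_mul, norm_div, norm_psi (M_lt_M_succ hm k), hn, coeff_blockSum hm, mul_one,
        Complex.norm_real, Real.norm_of_nonneg (mul_nonneg (hb0 k) (by positivity)),
        le_div_iff₀ (by positivity)]
      rw [← mul_div_assoc, lt_div_iff₀ hΦk] at hkq
      have hpow : (M m k : ℝ) ^ (1 / p - 1) = (M m k : ℝ) ^ (1 / p - 2) * M m k := by
        rw [← Real.rpow_add_one (hMpos k).ne']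
        ring_nf
      rw [hpow]
      calc 2 * T * Φ k * ((M m k : ℝ) + 1) ≤ 2 * T * Φ k * (2 * M m k) := by
            gcongr
            linarith
        _ = 4 * T * Φ k * M m k := by ring
        _ ≤ b k * (M m k : ℝ) ^ (1 / p - 2) * M m k := by gcongr
        _ = _ := by ring
    rw [Set.mem_ofPred_eq, norm_div, Complex.norm_real, Real.norm_of_nonneg hΦk.le,
      lt_div_iff₀ hΦk, fejer_M_succ hmart, add_comm]
    have := norm_sub_le_norm_add z (smoothPart m k (f k) x)
    linarith
  refine le_trans ?_ (measure_mono hsmall)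
  rw [prob_compl_eq_one_sub (measurableSet_le measurable_const
    (measurable_majorant (measurable_maximal hmart) B k))]
  refine ENNReal.le_sub_of_add_le_right (ne_top_of_le_ne_top (by simp) hlarge) ?_
  calc _ ≤ (2⁻¹ : ℝ≥0∞) + 2⁻¹ := by gcongr
    _ = 1 := ENNReal.inv_two_add_inv_two

theorem weakNorm_le_hardyNormFun {p : ℝ} (hp0 : 0 < p) {n : ℕ} {g : G m → ℂ}
    (hg : StronglyMeasurable[filtration m n] g) (hgi : Integrable g (haar m)) :
    weakNorm m p g ≤ hardyNormFun m p g := by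
  have hmeas : Measurable g := (hg.mono ((filtration m).le n)).measurable
  rw [weakNorm, hardyNormFun, hardyNorm]
  refine ENNReal.rpow_le_rpow (iSup₂_le fun t ht => ?_) (by positivity)
  have hset : {x | t < ‖g x‖} ⊆ {x | ENNReal.ofReal (t ^ p) ≤ ‖g x‖ₑ ^ p} := by
    intro x hx
    rw [Set.mem_ofPred_eq, ← ENNReal.ofReal_rpow_of_pos ht, ← ofReal_norm]
    exact ENNReal.rpow_le_rpow (ENNReal.ofReal_le_ofReal (le_of_lt hx)) hp0.le
  refine (mul_le_mul_right (measure_mono hset) _).trans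
    ((mul_meas_ge_le_lintegral (hmeas.enorm.pow_const p) _).trans (lintegral_mono fun x => ?_))
  refine ENNReal.rpow_le_rpow (le_iSup_of_le n ?_) hp0.le
  rw [condExp_of_stronglyMeasurable ((filtration m).le n) hg hgi]

theorem stronglyMeasurable_fejer (hm : ∀ n, 2 ≤ m n) (f : ℕ → G m → ℂ) (n : ℕ) :
    StronglyMeasurable[filtration m (n + 1)] (fejer m (M m n + 1) f) := by
  refine stronglyMeasurable_filtration fun x y h => ?_
  simp only [fejer, partialSum]
  congr 1
  refine Finset.sum_congr rfl fun k hk => Finset.sum_congr rfl fun i hi => ?_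
  have hk := (Finset.mem_Icc.mp hk).2
  have hi := Finset.mem_range.mp hi
  have := M_lt_M_succ hm n
  rw [psi_congr (n := n + 1) (by omega) h]

theorem integrable_fejer (hm : ∀ n, 2 ≤ m n) {f : ℕ → G m → ℂ}
    (hf : Martingale f (filtration m) (haar m)) (n : ℕ) :
    Integrable (fejer m (M m n + 1) f) (haar m) := by
  rw [funext fun x => fejer_M_succ hf n x]
  exact (integrable_smoothPart (hf.integrable n) n).add
    ((integrable_psi (M_lt_M_succ hm n)).const_mul _)

end LowerBound

end Vilenkin

theorem corollary3 (m : ℕ → ℕ) (hm : ∀ n, 2 ≤ m n) (hbdd : BddAbove (Set.range m))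
    (p : ℝ) (hp0 : 0 < p) (hp : p < 1 / 2) :
    -- the upper estimate
    (∃ c : ℝ≥0, ∀ f : ℕ → Vilenkin.G m → ℂ, Vilenkin.MemHardy m p f → ∀ n : ℕ,
      Vilenkin.hardyNormFun m p (Vilenkin.fejer m (Vilenkin.M m n + 1) f) ≤
        (c : ℝ≥0∞) * ENNReal.ofReal ((Vilenkin.M m n : ℝ) ^ (1 / p - 2)) *
          Vilenkin.hardyNorm m p f) ∧
    -- sharpness of the rate
    (∀ Φ : ℕ → ℝ, Monotone Φ →
      limsup (fun k : ℕ => (((Vilenkin.M m k : ℝ) ^ (1 / p - 2) / Φ k : ℝ) : EReal)) atTop = ⊤ →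
      ∃ f : ℕ → Vilenkin.G m → ℂ, Vilenkin.MemHardy m p f ∧
        ⨆ k : ℕ, Vilenkin.weakNorm m p
          (fun x => Vilenkin.fejer m (Vilenkin.M m k + 1) f x / (Φ k : ℂ)) = ∞) ∧
    -- the means are not uniformly bounded on the Hardy space
    (¬ ∃ C : ℝ≥0, ∀ f : ℕ → Vilenkin.G m → ℂ, Vilenkin.MemHardy m p f → ∀ n : ℕ,
      Vilenkin.hardyNormFun m p (Vilenkin.fejer m (Vilenkin.M m n + 1) f) ≤
        (C : ℝ≥0∞) * Vilenkin.hardyNorm m p f) := by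
  have : ∀ n, NeZero (m n) := fun n => ⟨by have := hm n; omega⟩
  obtain ⟨B, hB⟩ := hbdd
  have hB : ∀ n, m n ≤ B := fun n => hB ⟨n, rfl⟩
  have hp1 : p ≤ 1 := by linarith
  refine ⟨?_, fun Φ hΦ hlim => ?_, ?_⟩
  · have hc : (Vilenkin.majorantConst B p + (B : ℝ≥0∞) ^ (1 - p)) ^ (1 / p) ≠ ∞ :=
      ENNReal.rpow_ne_top_of_nonneg (by positivity) (ENNReal.add_ne_top.mpr
        ⟨Vilenkin.majorantConst_ne_top B hp0,
          ENNReal.rpow_ne_top_of_nonneg (by linarith) (ENNReal.natCast_ne_top B)⟩)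
    refine ⟨ENNReal.toNNReal
      ((Vilenkin.majorantConst B p + (B : ℝ≥0∞) ^ (1 - p)) ^ (1 / p)), fun f hf n => ?_⟩
    rw [ENNReal.coe_toNNReal hc]
    exact Vilenkin.hardyNormFun_fejer_le hm hB hp0 hp hf.1 n
  · refine Vilenkin.weakNorm_fejer_unbounded hm hB hp0 hp1 hΦ fun C => ?_
    have h := frequently_lt_of_lt_limsup (b := (C : EReal)) (by isBoundedDefault)
      (hlim ▸ EReal.coe_lt_top C)
    exact h.mono fun k hk => EReal.coe_lt_coe_iff.mp hk
  · rintro ⟨C, hC⟩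
    have hs : 0 < 1 / p - 2 := by
      rw [sub_pos, lt_div_iff₀ hp0]
      linarith
    obtain ⟨f, hf, hsup⟩ := Vilenkin.weakNorm_fejer_unbounded hm hB hp0 hp1
      (Φ := fun _ => 1) monotone_const fun C => by
        simpa using ((Vilenkin.tendsto_M_rpow hm hs).eventually_gt_atTop C).frequently
    have hle : ⨆ k : ℕ, Vilenkin.weakNorm m p
        (fun x => Vilenkin.fejer m (Vilenkin.M m k + 1) f x / ((1 : ℝ) : ℂ)) ≤
          C * Vilenkin.hardyNorm m p f := by
      refine iSup_le fun k => ?_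
      simp only [Complex.ofReal_one, div_one]
      exact (Vilenkin.weakNorm_le_hardyNormFun hp0 (Vilenkin.stronglyMeasurable_fejer hm f k)
        (Vilenkin.integrable_fejer hm hf.1 k)).trans (hC f hf k)
    rw [hsup] at hle
    exact (ENNReal.mul_lt_top ENNReal.coe_lt_top hf.2).not_ge hle
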